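/- For $L\ge 1$ consider the toric code on the $L\times L$ square lattice with periodic boundary conditions: qubits on the links, plaquette operators $A_\square=\prod_{i\in\square}X_i$, vertex operators $B_+=\prod_{i\in +}Z_i$, and code space $V_L=\{v: A_\square v=v=B_+v \text{ for all } \square,+\}$. A range-$r$ local channel (LC) transformation adds finitely many qubits in the state $|0\rangle$ to the lattice sites, applies a unitary circuit with (maximal range of the gates)$\,\times\,$(depth)$\,\le r$, and traces out some of the qubits; input and output may have any finite number of qubits on each site. An LC transformation (in the thermodynamic limit) is a family, indexed by $L$, of range-$r_L$ LC transformations with $r_L/L\to 0$. A family of states $\rho=(\rho_L)$ is in the toric code phase if there are states $\rho_a,\rho_b$ supported within $V_L$ and LC transformations $\mathcal C_1,\mathcal C_2$ with $\mathcal C_1(\rho_a)=\rho$ and $\mathcal C_2(\rho)=\rho_b$ for all large $L$. A channel $\mathcal N$ preserves the logical information if for all large $L$ there is a quantum channel $\mathcal R$ with $\mathcal R\circ\mathcal N(|\phi\rangle\langle\phi|)=|\phi\rangle\langle\phi|$ for all $|\phi\rangle\in V_L$. Let $\psi_L\in V_L$ be unit vectors. (1) Let $\mathcal N$ be an LC transformation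 acting on the toric code qubits such that $\mathcal N(|\psi\rangle\langle\psi|)$ is in the toric code phase. Then $\mathcal N$ preserves the logical information. More precisely, there is an LC transformation $\mathcal D$ such that $\mathrm{supp}\,\mathcal D(\mathcal N(|\psi\rangle\langle\psi|))\subseteq V_L$ for all large $L$; and for every such $\mathcal D$ and all large $L$ there is a unitary $U$ mapping $V_L$ into itself with $\mathcal D\circ\mathcal N(|\phi\rangle\langle\phi|)=U|\phi\rangle\langle\phi|U^\dagger$ for all $|\phi\rangle\in V_L$, so that $\mathcal R(\cdot)=U^\dagger\mathcal D(\cdot)U$ is a quantum channel with $\mathcal R\circ\mathcal N(|\phi\rangle\langle\phi|)=|\phi\rangle\langle\phi|$ for all $|\phi\rangle\in V_L$. (2) Let $(\mathcal N_p)_{p\in I}$, $I\subseteq[0,\infty)$, be LC transformations with strength parameter $p$, acting on the toric code qubits and with a common output lattice system. Let $p_{\rm t.c.}\in[0,\infty]$ be the least strength beyond which $\mathcal N_p(|\psi\rangle\langle\psi|)$ is no longer in the toric code phase, and $p_{\rm coding}\in[0,\infty]$ the least strength beyond which $\mathcal N_p$ no longer preserves the logical information. Then $p_{\rm t.c.}\le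 p_{\rm coding}$. -/

import Mathlib

open Filter Topology
open scoped Matrix ComplexOrder NNReal ENNReal

noncomputable section

namespace ToricCode

/-! ### Lattice and qubit registers -/

/-- Sites (vertices) of the `L × L` square lattice with periodic boundary conditions. -/
abbrev Site (L : ℕ+) : Type := ZMod (L : ℕ) × ZMod (L : ℕ)

/-- Graph distance on the periodic square lattice. -/
def siteDist {L : ℕ+} (x y : Site L) : ℕ :=
  (x.1 - y.1).valMinAbs.natAbs + (x.2 - y.2).valMinAbs.natAbs

/-- A finite collection of qubits, each located at a site of the lattice
(any finite number of qubits per site). -/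
structure Register (L : ℕ+) where
  Qubit : Type
  [fintypeQubit : Fintype Qubit]
  [decEqQubit : DecidableEq Qubit]
  site : Qubit → Site L

attribute [instance] Register.fintypeQubit Register.decEqQubit

/-- Computational basis labels. -/
abbrev Register.Config {L : ℕ+} (Q : Register L) : Type := Q.Qubit → Bool

/-- Vectors of the many-qubit Hilbert space, written in the computational basis. -/
abbrev Register.Vec {L : ℕ+} (Q : Register L) : Type := Q.Config → ℂ

/-- Operators on the many-qubit Hilbert space, written in the computational basis. -/
abbrev Register.Op {L : ℕ+} (Q : Register L) : Type := Matrix Q.Config Q.Config ℂ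

/-- The union of two registers. -/
abbrev Register.add {L : ℕ+} (Q A : Register L) : Register L where
  Qubit := Q.Qubit ⊕ A.Qubit
  site := Sum.elim Q.site A.site

/-! ### States and channels -/

variable {L : ℕ+}

/-- The operator `|ψ⟩⟨ψ|`. -/
def ketBra {Q : Register L} (ψ : Q.Vec) : Q.Op := Matrix.vecMulVec ψ (star ψ)

def IsUnitVector {Q : Register L} (ψ : Q.Vec) : Prop := star ψ ⬝ᵥ ψ = 1

/-- Density matrices. -/
def IsState {Q : Register L} (ρ : Q.Op) : Prop := ρ.PosSemidef ∧ ρ.trace = 1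

/-- `supp ρ ⊆ W`: the range of `ρ` lies in `W` (for Hermitian `ρ` the range is the support). -/
def SuppIn {Q : Register L} (ρ : Q.Op) (W : Submodule ℂ Q.Vec) : Prop :=
  ∀ v : Q.Vec, ρ *ᵥ v ∈ W

/-- The map `ρ ↦ A ρ A†`. -/
def conjBy {Q : Register L} (A : Q.Op) : Q.Op →ₗ[ℂ] Q.Op where
  toFun ρ := A * ρ * Aᴴ
  map_add' ρ σ := by rw [mul_add, add_mul]
  map_smul' c ρ := by simp

/-- Quantum channels: completely positive trace-preserving maps, in Kraus form. -/
def IsChannel {Q Q' : Register L} (Φ : Q.Op →ₗ[ℂ] Q'.Op) : Prop :=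
  ∃ (n : ℕ) (K : Fin n → Matrix Q'.Config Q.Config ℂ),
    ∑ k, (K k)ᴴ * K k = 1 ∧ ∀ ρ, Φ ρ = ∑ k, K k * ρ * (K k)ᴴ

/-! ### Local channel transformations -/

open Classical in
/-- `G` acts only on the qubits in `S`, i.e. `G = g ⊗ 1` with `g` an operator on the qubits
in `S` and `1` the identity on the others. -/
def ActsOn {Q : Register L} (S : Set Q.Qubit) (G : Q.Op) : Prop :=
  ∃ g : Matrix (S → Bool) (S → Bool) ℂ, ∀ s t : Q.Config,
    G s t = if ∀ i, i ∉ S → s i = t i then g (fun i => s i) (fun i => t i) else 0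

/-- A layer of a circuit: a product of unitary gates acting on mutually disjoint sets of qubits,
the sites of each gate being at mutual distance at most `w`. -/
def IsLayer {Q : Register L} (w : ℕ) (U : Q.Op) : Prop :=
  ∃ gates : List (Set Q.Qubit × Q.Op),
    (∀ g ∈ gates, g.2 ∈ Matrix.unitaryGroup Q.Config ℂ ∧ ActsOn g.1 g.2 ∧
      ∀ i ∈ g.1, ∀ j ∈ g.1, siteDist (Q.site i) (Q.site j) ≤ w) ∧
    gates.Pairwise (fun g h => Disjoint g.1 h.1) ∧
    U = (gates.map Prod.snd).prod

/-- A unitary circuit of range at most `r`: (range of the gates) times (depth) is at most `r`. -/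
def IsCircuit {Q : Register L} (r : ℕ) (U : Q.Op) : Prop :=
  ∃ (w : ℕ) (layers : List Q.Op),
    (∀ V ∈ layers, IsLayer w V) ∧ w * layers.length ≤ r ∧ U = layers.prod

/-- `ρ ↦ ρ ⊗ |0…0⟩⟨0…0|`. -/
def addZeros {Q : Register L} (A : Register L) (ρ : Q.Op) : (Q.add A).Op :=
  Matrix.of fun s t =>
    if (∀ a, s (Sum.inr a) = false) ∧ (∀ a, t (Sum.inr a) = false) then
      ρ (fun i => s (Sum.inl i)) (fun i => t (Sum.inl i)) else 0

/-- The partial trace over the register `T`. -/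
def traceOut {Q : Register L} (T : Register L) (M : (Q.add T).Op) : Q.Op :=
  Matrix.of fun s t => ∑ u : T.Config, M (Sum.elim s u) (Sum.elim t u)

/-- Relabelling of the qubits along a bijection. -/
def relabel {Q Q' : Register L} (e : Q.Qubit ≃ Q'.Qubit) (M : Q.Op) : Q'.Op :=
  Matrix.of fun s t => M (fun i => s (e i)) (fun i => t (e i))

/-- Range-`r` local channel transformation from the register `Q` to the register `Q'`:
add qubits in the state `|0⟩` (register `A`), apply a range-`r` unitary circuit, and
trace out some of the qubits (register `T`). The site-preserving bijection `e` says which of the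
qubits are kept and which are discarded. -/
def IsLC {Q Q' : Register L} (r : ℕ) (Φ : Q.Op →ₗ[ℂ] Q'.Op) : Prop :=
  ∃ (A T : Register L) (e : (Q.add A).Qubit ≃ (Q'.add T).Qubit) (U : (Q.add A).Op),
    (∀ i, (Q'.add T).site (e i) = (Q.add A).site i) ∧
    IsCircuit r U ∧
    ∀ ρ, Φ ρ = traceOut T (relabel e (U * addZeros A ρ * Uᴴ))

/-- A local channel transformation in the thermodynamic limit: one local channel transformation
for each linear size `L`, with range `r L` such that `r L / L → 0`. -/
def IsLCFamily {Q Q' : ∀ L, Register L} (Φ : ∀ L, (Q L).Op →ₗ[ℂ] (Q' L).Op) : Prop :=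
  ∃ r : ℕ+ → ℕ, Tendsto (fun L : ℕ+ => (r L : ℝ) / (L : ℝ)) atTop (𝓝 0) ∧
    ∀ L, IsLC (r L) (Φ L)

/-! ### The toric code -/

/-- The qubits of the toric code, on the links of the lattice: `(false, (x, y))` is the link from
`(x, y)` to `(x + 1, y)` and `(true, (x, y))` is the link from `(x, y)` to `(x, y + 1)`. -/
abbrev links (L : ℕ+) : Register L where
  Qubit := Bool × Site L
  site := Prod.snd

/-- Pauli `X` on the qubit `i`. -/
def pauliX {Q : Register L} (i : Q.Qubit) : Q.Op :=
  Matrix.of fun s t => if s = Function.update t i (!(t i)) then 1 else 0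

/-- Pauli `Z` on the qubit `i`. -/
def pauliZ {Q : Register L} (i : Q.Qubit) : Q.Op :=
  Matrix.diagonal fun s => if s i then -1 else 1

/-- `A_□`, the product of `X` over the boundary of the plaquette with lower left corner `x`. -/
def plaquetteOp (x : Site L) : (links L).Op :=
  pauliX (Q := links L) (false, x) * pauliX (Q := links L) (true, (x.1 + 1, x.2)) *
    pauliX (Q := links L) (false, (x.1, x.2 + 1)) * pauliX (Q := links L) (true, x)

/-- `B_+`, the product of `Z` over the links that meet the vertex `x`. -/
def vertexOp (x : Site L) : (links L).Op :=
  pauliZ (Q := links L) (false, x) * pauliZ (Q := links L) (false, (x.1 - 1, x.2)) *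
    pauliZ (Q := links L) (true, x) * pauliZ (Q := links L) (true, (x.1, x.2 - 1))

/-- The code space (ground space): the anyon-free vectors, on which every `A_□` and every `B_+`
has the value `+1`. -/
def codeSpace (L : ℕ+) : Submodule ℂ (links L).Vec where
  carrier := {v | ∀ x : Site L, plaquetteOp x *ᵥ v = v ∧ vertexOp x *ᵥ v = v}
  add_mem' {v w} hv hw x := by
    simp only [Set.mem_ofPred_eq] at hv hw
    simp [Matrix.mulVec_add, (hv x).1, (hv x).2, (hw x).1, (hw x).2]
  zero_mem' x := by simp
  smul_mem' c v hv x := by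
    simp only [Set.mem_ofPred_eq] at hv
    simp [Matrix.mulVec_smul, (hv x).1, (hv x).2]

/-- A (family of) mixed states `ρ` is in the toric code phase if `ρ_a → ρ → ρ_b` by local channel
transformations, for some states `ρ_a`, `ρ_b` within the code space. -/
def InToricCodePhase {Q : ∀ L, Register L} (ρ : ∀ L, (Q L).Op) : Prop :=
  ∃ (ρa ρb : ∀ L, (links L).Op) (C₁ : ∀ L, (links L).Op →ₗ[ℂ] (Q L).Op)
    (C₂ : ∀ L, (Q L).Op →ₗ[ℂ] (links L).Op),
    IsLCFamily C₁ ∧ IsLCFamily C₂ ∧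
    ∀ᶠ L in atTop, IsState (ρa L) ∧ SuppIn (ρa L) (codeSpace L) ∧
      IsState (ρb L) ∧ SuppIn (ρb L) (codeSpace L) ∧
      C₁ L (ρa L) = ρ L ∧ C₂ L (ρ L) = ρb L

/-- `R` is a recovery channel for the noise `N` on the code space. -/
def IsRecovery {Q : Register L} (N : (links L).Op →ₗ[ℂ] Q.Op) (R : Q.Op →ₗ[ℂ] (links L).Op) :
    Prop :=
  IsChannel R ∧ ∀ φ ∈ codeSpace L, R (N (ketBra φ)) = ketBra φ

/-- The logical information is preserved by the noise `N` (in the thermodynamic limit). -/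
def PreservesLogicalInfo {Q : ∀ L, Register L} (N : ∀ L, (links L).Op →ₗ[ℂ] (Q L).Op) : Prop :=
  ∀ᶠ L in atTop, ∃ R : (Q L).Op →ₗ[ℂ] (links L).Op, IsRecovery (N L) R

/-- `D` is a local channel transformation that takes the state `ρ` back to a state supported
within the code space. -/
def ReturnsToCode {Q : ∀ L, Register L} (D : ∀ L, (Q L).Op →ₗ[ℂ] (links L).Op)
    (ρ : ∀ L, (Q L).Op) : Prop :=
  IsLCFamily D ∧ ∀ᶠ L in atTop, SuppIn (D L (ρ L)) (codeSpace L)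

/-- Unitaries that map the code space to itself. -/
def IsLogicalUnitary (U : (links L).Op) : Prop :=
  U ∈ Matrix.unitaryGroup (links L).Config ℂ ∧ ∀ v ∈ codeSpace L, U *ᵥ v ∈ codeSpace L

/-- The critical strength of a property `P` of noise strengths in `I`: the least strength beyond
which `P` no longer holds. -/
def criticalStrength (I : Set ℝ≥0) (P : ℝ≥0 → Prop) : ℝ≥0∞ :=
  sInf {t : ℝ≥0∞ | ∀ p ∈ I, t < (p : ℝ≥0∞) → ¬ P p}

/-- The critical strength beyond which the noisy state is no longer in the toric code phase. -/
def pTC {Q : ∀ L, Register L} (I : Set ℝ≥0) (N : ℝ≥0 → ∀ L, (links L).Op →ₗ[ℂ] (Q L).Op)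
    (ψ : ∀ L, (links L).Vec) : ℝ≥0∞ :=
  criticalStrength I fun p => InToricCodePhase fun L => N p L (ketBra (ψ L))

/-- The critical strength beyond which the logical information is no longer recoverable. -/
def pCoding {Q : ∀ L, Register L} (I : Set ℝ≥0)
    (N : ℝ≥0 → ∀ L, (links L).Op →ₗ[ℂ] (Q L).Op) : ℝ≥0∞ :=
  criticalStrength I fun p => PreservesLogicalInfo (N p)

end ToricCode

end

/-! Let `Φ = D ∘ N`, with Kraus operators `K k` and range `r` much smaller than `L`, and let `P` be
the projection onto the code space. The claim is that one code state returning to the code space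
forces `Φ` to act on the whole code space as a unitary. Everything rests on the Heisenberg picture
`heis K O = ∑ (K k)ᴴ O (K k)`, which enlarges supports by at most `r` and is multiplicative on well
separated supports (`IsLC.exists_localKraus`).

Stabilizers (`stab_mul`). For a stabilizer `s` the operator `heis K s` is local, so it acts on the
code space as a scalar `c` (`sandwich_eq_smul`). The given code state shows `c = 1`. The squared
defects of `s K P = K P` then sum to zero (`sum_defect`), so every `K k` maps the code space into
itself.

Loops (`loop_mul`, `exists_pullback`). Parallel loops `W y` and `W z` act alike on the code space.
When they are far apart, multiplicativity makes the defects of `W y K P = K T P` and `W z K P = K T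
P`, with `T = heis K (W z)`, add up to zero. Pullbacks of distant loops therefore agree on the code
space. Since any stabilizer is far from one of them, the pullback commutes with `P`.

Irreducibility (`IsCodeOp.eq_smul`). It follows that `(K k P)(K l P)ᴴ` commutes with all logical
Pauli loops. An operator on the code space with this property is a multiple of `P`, because a closed
configuration with trivial winding is a boundary (`exists_bdry`). Hence all the `K k P` are
multiples of one unitary of the code space (`exists_unitary_of_kraus`), and undoing it after `D` is
the recovery.

The inequality of thresholds follows by applying this at each noise strength. -/

noncomputable section

namespace ToricCode

/-! ### Operators supported on a set of qubits -/

section LocalOperators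

variable {ι : Type*}

/-- Pointwise addition modulo 2 of configurations. -/
def xorC (s t : ι → Bool) : ι → Bool := fun i => xor (s i) (t i)

@[simp] theorem xorC_apply (s t : ι → Bool) (i : ι) : xorC s t i = xor (s i) (t i) := rfl

theorem xorC_self_right (s t : ι → Bool) : xorC (xorC s t) t = s := by
  ext i; simp

/-- Entrywise form of locality: `G` preserves the configuration outside `S`, and its entries do
not depend on that configuration. -/
structure LocalOn (S : Set ι) (G : Matrix (ι → Bool) (ι → Bool) ℂ) : Prop where
  eq_of_ne : ∀ s t i, i ∉ S → G s t ≠ 0 → s i = t i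
  shift : ∀ s t c, (∀ i ∈ S, c i = false) → G (xorC s c) (xorC t c) = G s t

theorem LocalOn.mono {S S' : Set ι} {G : Matrix (ι → Bool) (ι → Bool) ℂ} (h : LocalOn S G)
    (hS : S ⊆ S') : LocalOn S' G :=
  ⟨fun s t i hi => h.eq_of_ne s t i fun h' => hi (hS h'),
    fun s t c hc => h.shift s t c fun i hi => hc i (hS hi)⟩

theorem LocalOn.conjTranspose {S : Set ι} {G : Matrix (ι → Bool) (ι → Bool) ℂ}
    (h : LocalOn S G) : LocalOn S Gᴴ :=
  ⟨fun s t i hi hG => (h.eq_of_ne t s i hi (by simpa using hG)).symm,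
    fun s t c hc => by simp [h.shift t s c hc]⟩

/-- Translation of configurations as a permutation. -/
def xorEquiv (c : ι → Bool) : (ι → Bool) ≃ (ι → Bool) where
  toFun s := xorC s c
  invFun s := xorC s c
  left_inv s := xorC_self_right s c
  right_inv s := xorC_self_right s c

variable [Fintype ι] [DecidableEq ι]

theorem LocalOn.mul {S : Set ι} {G H : Matrix (ι → Bool) (ι → Bool) ℂ}
    (hG : LocalOn S G) (hH : LocalOn S H) : LocalOn S (G * H) := by
  refine ⟨fun s t i hi h => ?_, fun s t c hc => ?_⟩
  · rw [Matrix.mul_apply] at h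
    obtain ⟨u, -, hu⟩ := Finset.exists_ne_zero_of_sum_ne_zero h
    exact (hG.eq_of_ne s u i hi (left_ne_zero_of_mul hu)).trans
      (hH.eq_of_ne u t i hi (right_ne_zero_of_mul hu))
  · rw [Matrix.mul_apply, Matrix.mul_apply, ← (xorEquiv c).sum_comp]
    refine Finset.sum_congr rfl fun u _ => ?_
    change G _ (xorC u c) * H (xorC u c) _ = _
    rw [hG.shift _ _ _ hc, hH.shift _ _ _ hc]

/-- In the sum over intermediate configurations `u` for `G * H`, a nonzero term has `u = t` on `S`
and `u = s` on `S'`. The substitution `u ↦ u + s + t` exchanges these two roles and matches the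
terms of `G * H` with those of `H * G`. -/
theorem LocalOn.commute {S S' : Set ι} {G H : Matrix (ι → Bool) (ι → Bool) ℂ}
    (hG : LocalOn S G) (hH : LocalOn S' H) (hd : Disjoint S S') : G * H = H * G := by
  have key : ∀ {S S' : Set ι} {G H : Matrix (ι → Bool) (ι → Bool) ℂ}, LocalOn S G →
      LocalOn S' H → Disjoint S S' → ∀ s t u, G s u * H u t ≠ 0 →
      G s u * H u t = H s (xorC u (xorC s t)) * G (xorC u (xorC s t)) t := by
    intro S S' G H hG hH hd s t u h
    have h1 := hG.eq_of_ne s u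
    have h2 := hH.eq_of_ne u t
    have e1 : G (xorC u (xorC s t)) t = G s u := by
      rw [← hG.shift s u (xorC u t)]
      · congr 1 <;> ext i <;> simp only [xorC_apply] <;> cases s i <;> cases t i <;> cases u i <;> rfl
      · intro i hi
        have := h2 i (Set.disjoint_left.1 hd hi) (right_ne_zero_of_mul h)
        simp [this]
    have e2 : H s (xorC u (xorC s t)) = H u t := by
      rw [← hH.shift u t (xorC u s)]
      · congr 1 <;> ext i <;> simp only [xorC_apply] <;> cases s i <;> cases t i <;> cases u i <;> rfl
      · intro i hi
        have := h1 i (Set.disjoint_right.1 hd hi) (left_ne_zero_of_mul h)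
        simp [this]
    rw [e1, e2, mul_comm]
  ext s t
  rw [Matrix.mul_apply, Matrix.mul_apply, ← (xorEquiv (xorC s t)).sum_comp fun u => H s u * G u t]
  refine Finset.sum_congr rfl fun u _ => ?_
  change _ = H s (xorC u (xorC s t)) * G (xorC u (xorC s t)) t
  by_cases h : G s u * H u t = 0
  · by_cases h' : H s (xorC u (xorC s t)) * G (xorC u (xorC s t)) t = 0
    · rw [h, h']
    · rw [key hH hG hd.symm s t _ h', xorC_self_right]
  · exact key hG hH hd s t u h

theorem LocalOn.conj_of_disjoint {S S' : Set ι} {G U : Matrix (ι → Bool) (ι → Bool) ℂ}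
    (hG : LocalOn S G) (hU : LocalOn S' U) (hd : Disjoint S S') (hu : Uᴴ * U = 1) :
    Uᴴ * G * U = G := by
  rw [mul_assoc, hG.commute hU hd, ← mul_assoc, hu, one_mul]

end LocalOperators

variable {L : ℕ+}

theorem ActsOn.localOn {Q : Register L} {S : Set Q.Qubit} {G : Q.Op} (h : ActsOn S G) :
    LocalOn S G := by
  classical
  obtain ⟨g, hg⟩ := h
  refine ⟨fun s t i hi h => ?_, fun s t c hc => ?_⟩
  · rw [hg] at h
    split_ifs at h with h'
    · exact h' i hi
    · exact absurd rfl h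
  · have e : ∀ s : Q.Config, (fun i : S => xorC s c i) = fun i : S => s i := fun s => by
      ext i; simp [hc i i.2]
    have e' : (∀ i, i ∉ S → xorC s c i = xorC t c i) ↔ ∀ i, i ∉ S → s i = t i := by simp
    rw [hg, hg, e s, e t]
    simp only [e']

/-! ### Circuits -/

theorem siteDist_self (x : Site L) : siteDist x x = 0 := by simp [siteDist]

theorem siteDist_triangle (x y z : Site L) : siteDist x z ≤ siteDist x y + siteDist y z := by
  have h1 := ZMod.natAbs_valMinAbs_add_le (x.1 - y.1) (y.1 - z.1)
  have h2 := ZMod.natAbs_valMinAbs_add_le (x.2 - y.2) (y.2 - z.2)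
  rw [sub_add_sub_cancel] at h1 h2
  unfold siteDist
  have h1' := h1.trans (Int.natAbs_add_le _ _)
  have h2' := h2.trans (Int.natAbs_add_le _ _)
  omega

/-- The sites at distance at most `r` from `R`. -/
def thick (r : ℕ) (R : Set (Site L)) : Set (Site L) := {x | ∃ y ∈ R, siteDist x y ≤ r}

theorem thick_thick (r r' : ℕ) (R : Set (Site L)) : thick r (thick r' R) ⊆ thick (r' + r) R := by
  rintro x ⟨y, ⟨z, hz, hyz⟩, hxy⟩
  exact ⟨z, hz, (siteDist_triangle x y z).trans (by omega)⟩

theorem subset_thick (r : ℕ) (R : Set (Site L)) : R ⊆ thick r R :=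
  fun x hx => ⟨x, hx, by simp [siteDist_self]⟩

theorem thick_mono {r r' : ℕ} {R R' : Set (Site L)} (hr : r ≤ r') (hR : R ⊆ R') :
    thick r R ⊆ thick r' R' := fun _ ⟨y, hy, h⟩ => ⟨y, hR hy, h.trans hr⟩

/-- Locality with respect to a set of sites. -/
def SiteLocal {Q : Register L} (R : Set (Site L)) (G : Q.Op) : Prop :=
  LocalOn {i : Q.Qubit | Q.site i ∈ R} G

theorem SiteLocal.mono {Q : Register L} {R R' : Set (Site L)} {G : Q.Op} (h : SiteLocal R G)
    (hR : R ⊆ R') : SiteLocal R' G := LocalOn.mono h fun _ hi => hR hi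

theorem SiteLocal.commute {Q : Register L} {R R' : Set (Site L)} {G H : Q.Op}
    (hG : SiteLocal R G) (hH : SiteLocal R' H) (hd : Disjoint R R') : G * H = H * G :=
  LocalOn.commute hG hH
    (Set.disjoint_left.2 fun _ hi hi' => Set.disjoint_left.1 hd hi hi')

/-- Gates are absorbed one at a time. A gate that misses the support cancels against its adjoint. A
gate that meets it enlarges the support, but cannot draw in further gates of the same layer, since
these are disjoint from it. So a layer costs one gate diameter, whatever its number of gates. -/
theorem localOn_conj_gates {Q : Register L} (gates : List (Set Q.Qubit × Q.Op))
    (hg : ∀ g ∈ gates, g.2 ∈ Matrix.unitaryGroup Q.Config ℂ ∧ LocalOn g.1 g.2)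
    (hp : gates.Pairwise fun g h => Disjoint g.1 h.1) :
    ∀ (S : Set Q.Qubit) (O : Q.Op), LocalOn S O →
      LocalOn (S ∪ {i | ∃ g ∈ gates, i ∈ g.1 ∧ ¬ Disjoint g.1 S})
        ((gates.map Prod.snd).prodᴴ * O * (gates.map Prod.snd).prod) := by
  induction gates with
  | nil => intro S O hO; simpa using hO
  | cons g gs ih =>
    intro S O hO
    rw [List.pairwise_cons] at hp
    obtain ⟨hu, hl⟩ := hg g (by simp)
    have hu' : g.2ᴴ * g.2 = 1 := Matrix.mem_unitaryGroup_iff'.1 hu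
    have ih' := ih (fun g hg' => hg g (by simp [hg'])) hp.2
    have e : ((g :: gs).map Prod.snd).prodᴴ * O * ((g :: gs).map Prod.snd).prod =
        (gs.map Prod.snd).prodᴴ * (g.2ᴴ * O * g.2) * (gs.map Prod.snd).prod := by
      simp [Matrix.conjTranspose_mul, mul_assoc]
    rw [e]
    by_cases hd : Disjoint S g.1
    · rw [hO.conj_of_disjoint hl hd hu']
      refine (ih' S O hO).mono (Set.union_subset_union_right _ ?_)
      rintro i ⟨h, hh, hi⟩
      exact ⟨h, by simp [hh], hi⟩
    · have hO' : LocalOn (S ∪ g.1) (g.2ᴴ * O * g.2) :=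
        ((hl.conjTranspose.mono Set.subset_union_right).mul
          (hO.mono Set.subset_union_left)).mul (hl.mono Set.subset_union_right)
      refine (ih' _ _ hO').mono ?_
      rintro i ((hi | hi) | ⟨h, hh, hi, hn⟩)
      · exact Or.inl hi
      · exact Or.inr ⟨g, by simp, hi, fun h => hd h.symm⟩
      · refine Or.inr ⟨h, by simp [hh], hi, fun hS => hn ?_⟩
        exact Set.disjoint_union_right.2 ⟨hS, (hp.1 h hh).symm⟩

theorem IsLayer.unitary {Q : Register L} {w : ℕ} {U : Q.Op} (h : IsLayer w U) :
    U ∈ Matrix.unitaryGroup Q.Config ℂ := by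
  obtain ⟨gates, hg, -, rfl⟩ := h
  refine list_prod_mem fun x hx => ?_
  obtain ⟨g, hg', rfl⟩ := List.mem_map.1 hx
  exact (hg g hg').1

theorem IsLayer.siteLocal {Q : Register L} {w : ℕ} {U : Q.Op} (h : IsLayer w U)
    {R : Set (Site L)} {O : Q.Op} (hO : SiteLocal R O) : SiteLocal (thick w R) (Uᴴ * O * U) := by
  obtain ⟨gates, hg, hp, rfl⟩ := h
  refine (localOn_conj_gates gates (fun g hg' => ⟨(hg g hg').1, (hg g hg').2.1.localOn⟩) hp
    _ O hO).mono ?_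
  rintro i (hi | ⟨g, hg', hi, hn⟩)
  · exact subset_thick _ _ hi
  · obtain ⟨j, hj, hjR⟩ := Set.not_disjoint_iff.1 hn
    exact ⟨_, hjR, (hg g hg').2.2 i hi j hj⟩

theorem IsCircuit.unitary {Q : Register L} {r : ℕ} {U : Q.Op} (h : IsCircuit r U) :
    U ∈ Matrix.unitaryGroup Q.Config ℂ := by
  obtain ⟨w, layers, hl, -, rfl⟩ := h
  exact list_prod_mem fun x hx => (hl x hx).unitary

theorem IsCircuit.siteLocal {Q : Register L} {r : ℕ} {U : Q.Op} (h : IsCircuit r U)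
    {R : Set (Site L)} {O : Q.Op} (hO : SiteLocal R O) : SiteLocal (thick r R) (Uᴴ * O * U) := by
  obtain ⟨w, layers, hl, hr, rfl⟩ := h
  suffices ∀ (R : Set (Site L)) (O : Q.Op), SiteLocal R O →
      SiteLocal (thick (w * layers.length) R) (layers.prodᴴ * O * layers.prod) from
    (this R O hO).mono (thick_mono hr le_rfl)
  clear hr hO
  induction layers with
  | nil => intro R O hO; simpa using hO.mono (subset_thick _ _)
  | cons V Vs ih =>
    intro R O hO
    have := ih (fun V hV => hl V (by simp [hV])) _ _ ((hl V (by simp)).siteLocal hO)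
    have e : (V :: Vs).prodᴴ * O * (V :: Vs).prod = Vs.prodᴴ * (Vᴴ * O * V) * Vs.prod := by
      simp [Matrix.conjTranspose_mul, mul_assoc]
    rw [e]
    refine this.mono ((thick_thick _ _ _).trans (thick_mono ?_ le_rfl))
    simp [mul_add, add_comm]

/-! ### Kraus operators of local channel transformations -/

/-- The Heisenberg picture of the channel with Kraus operators `K`. -/
def heis {Q Q' : Register L} {κ : Type} [Fintype κ] (K : κ → Matrix Q'.Config Q.Config ℂ)
    (O : Q'.Op) : Q.Op := ∑ k, (K k)ᴴ * O * K k

/-- `K` is a Kraus representation of `Φ` whose Heisenberg picture enlarges supports by at most `r`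
and is multiplicative on operators with well separated supports. -/
structure IsLocalKraus {Q Q' : Register L} {κ : Type} [Fintype κ] (r : ℕ)
    (Φ : Q.Op →ₗ[ℂ] Q'.Op) (K : κ → Matrix Q'.Config Q.Config ℂ) : Prop where
  apply : ∀ ρ, Φ ρ = ∑ k, K k * ρ * (K k)ᴴ
  norm : ∑ k, (K k)ᴴ * K k = 1
  siteLocal : ∀ (R : Set (Site L)) (O : Q'.Op), SiteLocal R O → SiteLocal (thick r R) (heis K O)
  mul : ∀ (R R' : Set (Site L)) (O O' : Q'.Op), SiteLocal R O → SiteLocal R' O' →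
    Disjoint (thick r R) (thick r R') → heis K (O * O') = heis K O * heis K O'

theorem IsLocalKraus.isChannel {Q Q' : Register L} {κ : Type} [Fintype κ] {r : ℕ}
    {Φ : Q.Op →ₗ[ℂ] Q'.Op} {K : κ → Matrix Q'.Config Q.Config ℂ} (h : IsLocalKraus r Φ K) :
    IsChannel Φ := by
  refine ⟨Fintype.card κ, fun n => K ((Fintype.equivFin κ).symm n), ?_, fun ρ => ?_⟩
  · rw [← h.norm]
    exact (Fintype.equivFin κ).symm.sum_comp fun k => (K k)ᴴ * K k
  · rw [h.apply]
    exact ((Fintype.equivFin κ).symm.sum_comp fun k => K k * ρ * (K k)ᴴ).symm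

theorem heis_comp {Q Q' Q'' : Register L} {κ κ' : Type} [Fintype κ] [Fintype κ']
    (K : κ → Matrix Q'.Config Q.Config ℂ) (K' : κ' → Matrix Q''.Config Q'.Config ℂ) (O : Q''.Op) :
    heis (fun p : κ × κ' => K' p.2 * K p.1) O = heis K (heis K' O) := by
  simp only [heis, Fintype.sum_prod_type, Matrix.conjTranspose_mul, Matrix.mul_sum, Matrix.sum_mul,
    Matrix.mul_assoc]

theorem heis_one {Q Q' : Register L} {κ : Type} [Fintype κ]
    (K : κ → Matrix Q'.Config Q.Config ℂ) : heis K 1 = ∑ k, (K k)ᴴ * K k := by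
  simp [heis]

/-- The Heisenberg map of `Φ'` acts first. Disjointness after thickening by `r' + r` gives
disjointness after `r'`, for the first map, and of the `r`-thickenings of the already enlarged
supports, for the second. -/
theorem IsLocalKraus.comp {Q Q' Q'' : Register L} {κ κ' : Type} [Fintype κ] [Fintype κ']
    {r r' : ℕ} {Φ : Q.Op →ₗ[ℂ] Q'.Op} {Φ' : Q'.Op →ₗ[ℂ] Q''.Op}
    {K : κ → Matrix Q'.Config Q.Config ℂ} {K' : κ' → Matrix Q''.Config Q'.Config ℂ}
    (h : IsLocalKraus r Φ K) (h' : IsLocalKraus r' Φ' K') :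
    IsLocalKraus (r' + r) (Φ' ∘ₗ Φ) (fun p : κ × κ' => K' p.2 * K p.1) where
  apply ρ := by
    simp only [LinearMap.comp_apply, h.apply, h'.apply, Fintype.sum_prod_type_right,
      Matrix.conjTranspose_mul, Matrix.mul_sum, Matrix.sum_mul, Matrix.mul_assoc]
  norm := by rw [← heis_one, heis_comp, heis_one, h'.norm, heis_one, h.norm]
  siteLocal R O hO := by
    rw [heis_comp]
    exact (h.siteLocal _ _ (h'.siteLocal _ _ hO)).mono (thick_thick _ _ _)
  mul R R' O O' hO hO' hd := by
    rw [heis_comp, heis_comp, heis_comp, h'.mul R R' O O' hO hO', h.mul (thick r' R) (thick r' R')]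
    · exact h'.siteLocal _ _ hO
    · exact h'.siteLocal _ _ hO'
    · exact hd.mono (thick_thick _ _ _) (thick_thick _ _ _)
    · exact hd.mono (thick_mono (by omega) le_rfl) (thick_mono (by omega) le_rfl)

/-- A configuration extended by zeros to added qubits. -/
def extendZero {Q : Register L} (A : Register L) (s : Q.Config) : (Q.add A).Config :=
  Sum.elim s fun _ => false

/-- Kraus operators of a local channel transformation. -/
def lcKraus {Q Q' : Register L} (A T : Register L) (e : (Q.add A).Qubit ≃ (Q'.add T).Qubit)
    (U : (Q.add A).Op) (u : T.Config) : Matrix Q'.Config Q.Config ℂ :=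
  Matrix.of fun s t => U (fun i => Sum.elim s u (e i)) (extendZero A t)

/-- The operator `O ⊗ 1` on the qubits before the partial trace. -/
def liftOp {Q Q' : Register L} (A T : Register L) (e : (Q.add A).Qubit ≃ (Q'.add T).Qubit)
    (O : Q'.Op) : (Q.add A).Op :=
  Matrix.of fun s t => if ∀ a, s (e.symm (Sum.inr a)) = t (e.symm (Sum.inr a)) then
    O (fun i => s (e.symm (Sum.inl i))) (fun i => t (e.symm (Sum.inl i))) else 0

/-- Splitting of the configurations along the discarded register. -/
def splitConfig {Q Q' : Register L} (A T : Register L)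
    (e : (Q.add A).Qubit ≃ (Q'.add T).Qubit) : T.Config × Q'.Config ≃ (Q.add A).Config where
  toFun p := fun i => Sum.elim p.2 p.1 (e i)
  invFun s := (fun a => s (e.symm (Sum.inr a)), fun i => s (e.symm (Sum.inl i)))
  left_inv p := by ext <;> simp
  right_inv s := by
    ext i
    obtain ⟨j, rfl⟩ := e.symm.surjective i
    cases j <;> simp

theorem liftOp_apply_split {Q Q' : Register L} (A T : Register L)
    (e : (Q.add A).Qubit ≃ (Q'.add T).Qubit) (O : Q'.Op) (p q : T.Config × Q'.Config) :
    liftOp A T e O (splitConfig A T e p) (splitConfig A T e q) =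
      if p.1 = q.1 then O p.2 q.2 else 0 := by
  simp [liftOp, splitConfig, funext_iff]

theorem liftOp_mul {Q Q' : Register L} (A T : Register L)
    (e : (Q.add A).Qubit ≃ (Q'.add T).Qubit) (O O' : Q'.Op) :
    liftOp A T e (O * O') = liftOp A T e O * liftOp A T e O' := by
  ext s t
  obtain ⟨p, rfl⟩ := (splitConfig A T e).surjective s
  obtain ⟨q, rfl⟩ := (splitConfig A T e).surjective t
  rw [Matrix.mul_apply, ← (splitConfig A T e).sum_comp, Fintype.sum_prod_type]
  simp only [liftOp_apply_split, ite_mul, zero_mul, mul_ite, mul_zero]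
  rw [Finset.sum_eq_single p.1]
  · by_cases h : p.1 = q.1 <;> simp [h, Matrix.mul_apply]
  · intro b _ hb; simp [Ne.symm hb]
  · simp

theorem liftOp_one {Q Q' : Register L} (A T : Register L)
    (e : (Q.add A).Qubit ≃ (Q'.add T).Qubit) : liftOp A T e 1 = 1 := by
  ext s t
  obtain ⟨p, rfl⟩ := (splitConfig A T e).surjective s
  obtain ⟨q, rfl⟩ := (splitConfig A T e).surjective t
  simp only [liftOp_apply_split, Matrix.one_apply, EmbeddingLike.apply_eq_iff_eq, Prod.ext_iff]
  split_ifs <;> simp_all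

theorem liftOp_siteLocal {Q Q' : Register L} (A T : Register L)
    (e : (Q.add A).Qubit ≃ (Q'.add T).Qubit)
    (he : ∀ i, (Q'.add T).site (e i) = (Q.add A).site i) {R : Set (Site L)} {O : Q'.Op}
    (hO : SiteLocal R O) : SiteLocal R (liftOp A T e O) := by
  have hs : ∀ j, (Q.add A).site (e.symm (Sum.inl j)) = Q'.site j := fun j => by
    rw [← he, e.apply_symm_apply]
    rfl
  refine ⟨fun s t i hi h => ?_, fun s t c hc => ?_⟩
  · simp only [liftOp, Matrix.of_apply] at h
    split_ifs at h with h'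
    · obtain ⟨j, rfl⟩ := e.symm.surjective i
      cases j with
      | inl j =>
        refine hO.eq_of_ne _ _ j (fun hj => hi ?_) h
        change (Q.add A).site _ ∈ R
        rw [hs]
        exact hj
      | inr a => exact h' a
    · exact absurd rfl h
  · have := hO.shift (fun i => s (e.symm (Sum.inl i))) (fun i => t (e.symm (Sum.inl i)))
      (fun i => c (e.symm (Sum.inl i))) (fun i hi => hc _ (by
        change (Q.add A).site _ ∈ R
        rw [hs]
        exact hi))
    simp only [liftOp, Matrix.of_apply, xorC_apply, Bool.xor_left_inj]
    rw [← this]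
    rfl

/-- The compression of an operator to added qubits in the state `|0⟩`. -/
def zeroBlock {Q : Register L} (A : Register L) (M : (Q.add A).Op) : Q.Op :=
  Matrix.of fun s t => M (extendZero A s) (extendZero A t)

theorem zeroBlock_siteLocal {Q : Register L} (A : Register L) {R : Set (Site L)}
    {M : (Q.add A).Op} (hM : SiteLocal R M) : SiteLocal R (zeroBlock A M) := by
  refine ⟨fun s t i hi h => hM.eq_of_ne _ _ (Sum.inl i) hi h, fun s t c hc => ?_⟩
  have := hM.shift (extendZero A s) (extendZero A t) (extendZero A c) (by
    rintro (i | a) hi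
    · exact hc i hi
    · rfl)
  have e : ∀ s : Q.Config, xorC (extendZero A s) (extendZero A c) = extendZero A (xorC s c) := by
    intro s; ext i; cases i <;> simp [extendZero]
  rw [e, e] at this
  exact this

/-- Compression to a block is not multiplicative in general. Here each added qubit lies outside `R`
or outside `R'`, so one of the two factors cannot change it, and only intermediate states with all
added qubits at zero contribute. -/
theorem zeroBlock_mul {Q : Register L} (A : Register L) {R R' : Set (Site L)}
    {M M' : (Q.add A).Op} (hM : SiteLocal R M) (hM' : SiteLocal R' M') (hd : Disjoint R R') :
    zeroBlock A (M * M') = zeroBlock A M * zeroBlock A M' := by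
  ext s t
  change (M * M') (extendZero A s) (extendZero A t) = _
  rw [Matrix.mul_apply, Matrix.mul_apply]
  have hinj : Function.Injective (extendZero A : Q.Config → _) := fun s t h => by
    ext i; simpa [extendZero] using congrFun h (Sum.inl i)
  refine (Finset.sum_of_injOn (extendZero A) hinj.injOn (by simp) (fun u _ hu => ?_)
    fun u _ => rfl).symm
  by_contra h
  have h1 : M (extendZero A s) u ≠ 0 := left_ne_zero_of_mul h
  have h2 : M' u (extendZero A t) ≠ 0 := right_ne_zero_of_mul h
  refine hu ⟨fun i => u (Sum.inl i), by simp, ?_⟩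
  ext i
  cases i with
  | inl i => rfl
  | inr a =>
    by_cases ha : A.site a ∈ R
    · exact (hM'.eq_of_ne u _ (Sum.inr a) (Set.disjoint_left.1 hd ha) h2).symm
    · exact hM.eq_of_ne (extendZero A s) u (Sum.inr a) ha h1

/-- This is the Stinespring form: append the identity on the discarded qubits, evolve backwards
through the circuit, and take the block in which the added qubits are zero. Locality can be read off
from each of the three operations. -/
theorem heis_lcKraus {Q Q' : Register L} (A T : Register L)
    (e : (Q.add A).Qubit ≃ (Q'.add T).Qubit) (U : (Q.add A).Op) (O : Q'.Op) :
    heis (lcKraus A T e U) O = zeroBlock A (Uᴴ * liftOp A T e O * U) := by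
  ext s t
  simp only [heis, zeroBlock, Matrix.sum_apply, Matrix.mul_apply, Matrix.of_apply,
    Matrix.conjTranspose_apply]
  rw [← (splitConfig A T e).sum_comp, Fintype.sum_prod_type]
  refine Finset.sum_congr rfl fun u _ => Finset.sum_congr rfl fun q _ => ?_
  rw [← (splitConfig A T e).sum_comp, Fintype.sum_prod_type, Finset.sum_eq_single u]
  · simp only [liftOp_apply_split, if_true]
    rfl
  · intro b _ hb
    simp [liftOp_apply_split, hb]
  · simp

theorem IsLC.exists_localKraus {Q Q' : Register L} {r : ℕ} {Φ : Q.Op →ₗ[ℂ] Q'.Op}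
    (h : IsLC r Φ) : ∃ (κ : Type) (_ : Fintype κ) (K : κ → Matrix Q'.Config Q.Config ℂ),
      IsLocalKraus r Φ K := by
  obtain ⟨A, T, e, U, he, hU, hΦ⟩ := h
  have huU : U * Uᴴ = 1 := Matrix.mem_unitaryGroup_iff.1 hU.unitary
  have hUu : Uᴴ * U = 1 := Matrix.mem_unitaryGroup_iff'.1 hU.unitary
  refine ⟨T.Config, inferInstance, lcKraus A T e U, fun ρ => ?_, ?_, fun R O hO => ?_,
    fun R R' O O' hO hO' hd => ?_⟩
  · rw [hΦ]
    ext s t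
    have hinj : Function.Injective (extendZero A : Q.Config → _) := fun s t h => by
      ext i; simpa [extendZero] using congrFun h (Sum.inl i)
    have hz : ∀ u : (Q.add A).Config, (∀ a, u (Sum.inr a) = false) →
        extendZero A (fun i => u (Sum.inl i)) = u := fun u hu => by
      ext i
      cases i with
      | inl i => rfl
      | inr a => exact (hu a).symm
    simp only [traceOut, relabel, Matrix.sum_apply, Matrix.mul_apply, Matrix.of_apply,
      Matrix.conjTranspose_apply]
    refine Finset.sum_congr rfl fun u _ => ?_
    refine (Finset.sum_of_injOn (extendZero A) hinj.injOn (by simp) (fun v _ hv => ?_)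
      fun v _ => ?_).symm
    · rw [Finset.sum_eq_zero, zero_mul]
      intro w _
      rw [addZeros, Matrix.of_apply, if_neg, mul_zero]
      exact fun h => hv ⟨_, by simp, hz v h.2⟩
    · congr 1
      refine Finset.sum_of_injOn (extendZero A) hinj.injOn (by simp) (fun w _ hw => ?_)
        fun w _ => ?_
      · rw [addZeros, Matrix.of_apply, if_neg, mul_zero]
        exact fun h => hw ⟨_, by simp, hz w h.1⟩
      · simp [addZeros, extendZero, lcKraus]
  · rw [← heis_one, heis_lcKraus, liftOp_one, mul_one, hUu]
    ext s t
    simp only [zeroBlock, Matrix.of_apply, Matrix.one_apply]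
    congr 1
    simp [extendZero, funext_iff]
  · rw [heis_lcKraus]
    exact zeroBlock_siteLocal A (hU.siteLocal (liftOp_siteLocal A T e he hO))
  · have hc : ∀ X Y : (Q.add A).Op, Uᴴ * (X * Y) * U = (Uᴴ * X * U) * (Uᴴ * Y * U) := by
      intro X Y
      calc Uᴴ * (X * Y) * U = Uᴴ * X * 1 * Y * U := by simp only [mul_one, mul_assoc]
        _ = _ := by rw [← huU]; simp only [mul_assoc]
    rw [heis_lcKraus, heis_lcKraus, heis_lcKraus, liftOp_mul, hc]
    exact zeroBlock_mul A (hU.siteLocal (liftOp_siteLocal A T e he hO))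
      (hU.siteLocal (liftOp_siteLocal A T e he hO')) hd

/-! ### Pauli strings -/

/-- The sign `(-1)^b`. -/
def sg (b : Bool) : ℤˣ := if b then -1 else 1

theorem sg_xor (a b : Bool) : sg (xor a b) = sg a * sg b := by
  cases a <;> cases b <;> simp [sg]

@[simp] theorem sg_false : sg false = 1 := rfl

theorem sg_injective : Function.Injective sg := by
  intro a b h
  cases a <;> cases b <;> first | rfl | exact absurd h (by decide)

theorem exists_sg_eq (u : ℤˣ) : ∃ b, sg b = u := by
  obtain rfl | rfl := Int.units_eq_one_or u
  · exact ⟨false, rfl⟩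
  · exact ⟨true, rfl⟩

section PauliStrings

variable {ι : Type*}

theorem eq_xorC_comm {s t c : ι → Bool} : s = xorC t c ↔ xorC s c = t :=
  ⟨fun h => by rw [h, xorC_self_right], fun h => by rw [← h, xorC_self_right]⟩

variable [Fintype ι]

/-- The product of `X` over the qubits marked by `c`. -/
def shiftOp (c : ι → Bool) : Matrix (ι → Bool) (ι → Bool) ℂ :=
  Matrix.of fun s t => if s = xorC t c then 1 else 0

/-- The diagonal operator with entries `f s = ±1`. -/
def signOp (f : (ι → Bool) → ℤˣ) : Matrix (ι → Bool) (ι → Bool) ℂ :=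
  Matrix.diagonal fun s => ((f s : ℤ) : ℂ)

theorem shiftOp_conjTranspose (c : ι → Bool) : (shiftOp c)ᴴ = shiftOp c := by
  ext s t
  simp only [shiftOp, Matrix.conjTranspose_apply, Matrix.of_apply, eq_xorC_comm (s := s)]
  rw [apply_ite star, star_one, star_zero]
  congr 1
  rw [eq_iff_iff]
  exact eq_comm

theorem signOp_conjTranspose (f : (ι → Bool) → ℤˣ) : (signOp f)ᴴ = signOp f := by
  rw [signOp, Matrix.diagonal_conjTranspose]
  congr 1
  ext s
  simp

theorem localOn_shiftOp {S : Set ι} {c : ι → Bool} (hc : ∀ i, i ∉ S → c i = false) :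
    LocalOn S (shiftOp c) := by
  refine ⟨fun s t i hi h => ?_, fun s t d _ => ?_⟩
  · simp only [shiftOp, Matrix.of_apply, ne_eq, ite_eq_right_iff, one_ne_zero, imp_false,
      not_not] at h
    simp [h, hc i hi]
  · simp only [shiftOp, Matrix.of_apply]
    congr 1
    rw [eq_iff_iff, ← eq_xorC_comm, show xorC (xorC (xorC t d) c) d = xorC t c by
      ext i; simp only [xorC_apply]; cases t i <;> cases c i <;> cases d i <;> rfl]

theorem localOn_signOp {S : Set ι} {f : (ι → Bool) → ℤˣ}
    (hf : ∀ s c, (∀ i ∈ S, c i = false) → f (xorC s c) = f s) : LocalOn S (signOp f) := by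
  refine ⟨fun s t i _ h => ?_, fun s t c hc => ?_⟩
  · by_contra hne
    exact h (Matrix.diagonal_apply_ne _ fun h' => hne (by rw [h']))
  · simp only [signOp, Matrix.diagonal_apply, hf s c hc]
    congr 1
    rw [eq_iff_iff]
    exact (xorEquiv c).apply_eq_iff_eq

variable [DecidableEq ι]

theorem shiftOp_mul_apply (c : ι → Bool) (M : Matrix (ι → Bool) (ι → Bool) ℂ) (s t : ι → Bool) :
    (shiftOp c * M) s t = M (xorC s c) t := by
  simp [Matrix.mul_apply, shiftOp, eq_xorC_comm]

theorem mul_shiftOp_apply (c : ι → Bool) (M : Matrix (ι → Bool) (ι → Bool) ℂ) (s t : ι → Bool) :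
    (M * shiftOp c) s t = M s (xorC t c) := by
  simp [Matrix.mul_apply, shiftOp]

theorem signOp_mul_apply (f : (ι → Bool) → ℤˣ) (M : Matrix (ι → Bool) (ι → Bool) ℂ)
    (s t : ι → Bool) : (signOp f * M) s t = ((f s : ℤ) : ℂ) * M s t := by
  simp [signOp]

theorem mul_signOp_apply (f : (ι → Bool) → ℤˣ) (M : Matrix (ι → Bool) (ι → Bool) ℂ)
    (s t : ι → Bool) : (M * signOp f) s t = M s t * ((f t : ℤ) : ℂ) := by
  simp [signOp]

theorem shiftOp_mul_shiftOp (c d : ι → Bool) : shiftOp c * shiftOp d = shiftOp (xorC d c) := by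
  ext s t
  rw [shiftOp_mul_apply]
  simp only [shiftOp, Matrix.of_apply]
  congr 1
  rw [← eq_xorC_comm, eq_iff_iff]
  have : xorC (xorC t d) c = xorC t (xorC d c) := by ext; simp
  rw [this]

theorem shiftOp_mul_self (c : ι → Bool) : shiftOp c * shiftOp c = 1 := by
  ext s t
  rw [shiftOp_mul_apply, shiftOp, Matrix.of_apply, Matrix.one_apply]
  congr 1
  rw [eq_iff_iff]
  exact ⟨fun h => by rw [← xorC_self_right s c, h, xorC_self_right], fun h => by rw [h]⟩

theorem signOp_mul_signOp (f g : (ι → Bool) → ℤˣ) :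
    signOp f * signOp g = signOp fun s => f s * g s := by
  simp [signOp]

theorem signOp_mul_self (f : (ι → Bool) → ℤˣ) : signOp f * signOp f = 1 := by
  rw [signOp_mul_signOp]
  simp [signOp, Int.units_mul_self]

theorem shiftOp_single_eq (i : ι) :
    (Matrix.of fun s t : ι → Bool => if s = Function.update t i (!(t i)) then (1 : ℂ) else 0) =
      shiftOp fun j => decide (j = i) := by
  ext s t
  simp only [shiftOp, Matrix.of_apply]
  congr 2
  ext j
  by_cases h : j = i
  · subst h; simp
  · simp [h]

end PauliStrings

theorem pauliX_eq {Q : Register L} (i : Q.Qubit) :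
    pauliX i = shiftOp fun j => decide (j = i) := shiftOp_single_eq i

theorem pauliZ_eq {Q : Register L} (i : Q.Qubit) :
    pauliZ i = signOp fun s => sg (s i) := by
  unfold pauliZ signOp
  congr 1
  ext s
  by_cases h : s i = true <;> simp [sg, h]

/-! ### Stabilizers and loops -/

/-- The links in the boundary of the set of plaquettes `F`. -/
def bdry (F : Site L → Bool) : (links L).Config := fun l =>
  xor (F l.2) (F (if l.1 then (l.2.1 - 1, l.2.2) else (l.2.1, l.2.2 - 1)))

theorem plaquetteOp_eq (x : Site L) : plaquetteOp x = shiftOp (bdry fun p => decide (p = x)) := by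
  unfold plaquetteOp
  rw [pauliX_eq, pauliX_eq, pauliX_eq, pauliX_eq, shiftOp_mul_shiftOp, shiftOp_mul_shiftOp,
    shiftOp_mul_shiftOp]
  congr 1
  ext ⟨b, p, q⟩
  obtain ⟨x, y⟩ := x
  cases b <;> simp [bdry, sub_eq_iff_eq_add, Bool.xor_comm]

/-- The eigenvalue of the vertex operator at `x`. -/
def vertSign (x : Site L) (s : (links L).Config) : ℤˣ :=
  sg (s (false, x)) * sg (s (false, (x.1 - 1, x.2))) * sg (s (true, x)) *
    sg (s (true, (x.1, x.2 - 1)))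

theorem vertexOp_eq (x : Site L) : vertexOp x = signOp (vertSign x) := by
  unfold vertexOp
  rw [pauliZ_eq, pauliZ_eq, pauliZ_eq, pauliZ_eq, signOp_mul_signOp, signOp_mul_signOp,
    signOp_mul_signOp]
  rfl

/-- The plaquette and vertex operators. -/
def IsStab (s : (links L).Op) : Prop := ∃ x, s = plaquetteOp x ∨ s = vertexOp x

theorem IsStab.conjTranspose {s : (links L).Op} (h : IsStab s) : sᴴ = s := by
  obtain ⟨x, rfl | rfl⟩ := h
  · rw [plaquetteOp_eq, shiftOp_conjTranspose]
  · rw [vertexOp_eq, signOp_conjTranspose]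

theorem IsStab.mul_self {s : (links L).Op} (h : IsStab s) : s * s = 1 := by
  obtain ⟨x, rfl | rfl⟩ := h
  · rw [plaquetteOp_eq, shiftOp_mul_self]
  · rw [vertexOp_eq, signOp_mul_self]

theorem mem_codeSpace_iff {v : (links L).Vec} :
    v ∈ codeSpace L ↔ ∀ s : (links L).Op, IsStab s → s *ᵥ v = v := by
  constructor
  · rintro h s ⟨x, rfl | rfl⟩
    · exact (h x).1
    · exact (h x).2
  · exact fun h x => ⟨h _ ⟨x, Or.inl rfl⟩, h _ ⟨x, Or.inr rfl⟩⟩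

/-- The coordinate transverse to the loops of direction `b`. -/
def coord (b : Bool) (p : Site L) : ZMod L := if b then p.1 else p.2

/-- The distance on a cycle. -/
def cycDist (x y : ZMod L) : ℕ := (x - y).valMinAbs.natAbs

/-- The sites at distance at most `r` from a line. -/
def strip (b : Bool) (y : ZMod L) (r : ℕ) : Set (Site L) := {p | cycDist (coord b p) y ≤ r}

theorem cycDist_triangle (x y z : ZMod L) : cycDist x z ≤ cycDist x y + cycDist y z := by
  have h1 := ZMod.natAbs_valMinAbs_add_le (x - y) (y - z)
  rw [sub_add_sub_cancel] at h1
  exact h1.trans (Int.natAbs_add_le _ _)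

theorem cycDist_self (x : ZMod L) : cycDist x x = 0 := by simp [cycDist]

theorem cycDist_comm (x y : ZMod L) : cycDist x y = cycDist y x := by
  unfold cycDist
  rw [← neg_sub, ZMod.natAbs_valMinAbs_neg]

theorem cycDist_coord_le (b : Bool) (p q : Site L) :
    cycDist (coord b p) (coord b q) ≤ siteDist p q := by
  cases b <;> simp [coord, cycDist, siteDist]

theorem cycDist_add_natCast (y : ZMod L) {n : ℕ} (hn : 2 * n ≤ (L : ℕ)) :
    cycDist (y + (n : ZMod L)) y = n := by
  unfold cycDist
  rw [add_sub_cancel_left, ZMod.valMinAbs_natCast_of_le_half (by omega)]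
  simp

theorem cycDist_add_one_le (y : ZMod L) : cycDist (y + 1) y ≤ 1 := by
  unfold cycDist
  rw [add_sub_cancel_left]
  refine ZMod.natAbs_min_of_le_div_two (L : ℕ) _ 1 (by simp) ?_
  exact ZMod.natAbs_valMinAbs_le _

theorem thick_strip (b : Bool) (y : ZMod L) (r r' : ℕ) :
    thick r (strip b y r') ⊆ strip b y (r' + r) := by
  rintro p ⟨q, hq, hpq⟩
  have h1 := cycDist_triangle (coord b p) (coord b q) y
  have h2 := cycDist_coord_le b p q
  change cycDist _ _ ≤ r' at hq
  change cycDist _ _ ≤ _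
  omega

theorem strip_disjoint {b : Bool} {y z : ZMod L} {r r' : ℕ} (h : r + r' < cycDist y z) :
    Disjoint (strip b y r) (strip b z r') := by
  refine Set.disjoint_left.2 fun p hp hp' => ?_
  change cycDist _ _ ≤ _ at hp hp'
  have := cycDist_triangle y (coord b p) z
  rw [cycDist_comm] at hp
  omega

/-- Smallness is recorded as containment in a narrow strip of each direction. This is what allows
loops of both directions to be moved off the support. -/
theorem IsStab.siteLocal {s : (links L).Op} (h : IsStab s) :
    ∃ x : Site L, ∀ b, SiteLocal (strip b (coord b x) 1) s := by
  obtain ⟨x, hx⟩ := h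
  refine ⟨x, fun b => ?_⟩
  have h1 : ∀ y z : ZMod L, y - z = 1 ∨ y = z ∨ z - y = 1 → cycDist y z ≤ 1 := by
    rintro y z (h | rfl | h)
    · rw [← sub_add_cancel y z, h, add_comm]; exact cycDist_add_one_le _
    · simp [cycDist_self]
    · rw [← sub_add_cancel z y, h, add_comm, cycDist_comm]; exact cycDist_add_one_le _
  have hm : ∀ l : (links L).Qubit, (∀ b, coord b l.2 - coord b x = 1 ∨ coord b l.2 = coord b x ∨
      coord b x - coord b l.2 = 1) →
      l ∈ {i : (links L).Qubit | (links L).site i ∈ strip b (coord b x) 1} :=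
    fun l hl => h1 _ _ (hl b)
  rcases hx with rfl | rfl
  · rw [plaquetteOp_eq]
    refine localOn_shiftOp fun l hl => ?_
    by_contra hne
    refine hl (hm l ?_)
    obtain ⟨b', p, q⟩ := l
    obtain ⟨x, y⟩ := x
    cases b' <;> simp [bdry] at hne <;> intro b <;> cases b <;> simp [coord] <;> grind
  · rw [vertexOp_eq]
    refine localOn_signOp fun s c hc => ?_
    simp only [vertSign, xorC_apply]
    rw [hc _ (hm _ ?_), hc _ (hm _ ?_), hc _ (hm _ ?_), hc _ (hm _ ?_)]
    · simp
    all_goals intro b; cases b <;> simp [coord]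

/-- The loop of links of direction `b` at position `y`. -/
def lineX (b : Bool) (y : ZMod L) : (links L).Config := fun l =>
  decide (l.1 = b ∧ coord b l.2 = y)

/-- The site with transverse coordinate `y` and longitudinal coordinate `z`. -/
def lineSite (b : Bool) (y z : ZMod L) : Site L := if b then (y, z) else (z, y)

/-- The parity of a configuration on the links that cross a line. -/
def lineZ (b : Bool) (y : ZMod L) (s : (links L).Config) : ℤˣ :=
  ∏ z, sg (s (!b, lineSite b y z))

theorem coord_lineSite (b : Bool) (y z : ZMod L) : coord b (lineSite b y z) = y := by
  cases b <;> rfl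

theorem siteLocal_shiftOp_lineX (b : Bool) (y : ZMod L) :
    SiteLocal (strip b y 0) (shiftOp (lineX b y) : (links L).Op) := by
  refine localOn_shiftOp fun l hl => ?_
  simp only [lineX, decide_eq_false_iff_not, not_and]
  rintro - h
  refine hl ?_
  change cycDist (coord b l.2) y ≤ 0
  rw [h, cycDist_self]

theorem siteLocal_signOp_lineZ (b : Bool) (y : ZMod L) :
    SiteLocal (strip b y 0) (signOp (lineZ b y) : (links L).Op) := by
  refine localOn_signOp fun s c hc => ?_
  refine Finset.prod_congr rfl fun z _ => ?_
  rw [xorC_apply, hc, Bool.xor_false]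
  change cycDist (coord b (lineSite b y z)) y ≤ 0
  rw [coord_lineSite, cycDist_self]

/-! ### Homology of the torus -/

/-- Configurations on which all vertex operators have the value `+1`. -/
def IsClosedConfig (s : (links L).Config) : Prop := ∀ x, vertSign x s = 1

theorem eq_zero_of_step {β : Type*} (f : ZMod L → β) (h : ∀ y, f (y + 1) = f y) (y : ZMod L) :
    f y = f 0 := by
  obtain ⟨n, rfl⟩ := ZMod.natCast_zmod_surjective y
  induction n with
  | zero => simp
  | succ n ih => rw [Nat.cast_succ, h, ih]

/-- Partial products serve as a discrete primitive on the cycle; the trivial total product removes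
the jump at the end. -/
theorem exists_potential {G : Type*} [CommGroup G] (g : ZMod L → G) (hg : ∏ x, g x = 1) :
    ∃ f : ZMod L → G, f 0 = 1 ∧ ∀ x, f x = f (x - 1) * g x := by
  have hprod : ∏ i ∈ Finset.range L, g ((i : ZMod L) + 1) = 1 := by
    rw [← hg, ← Equiv.prod_comp (Equiv.addRight (1 : ZMod L)) g]
    refine Finset.prod_bij' (fun i _ => (i : ZMod L)) (fun x _ => x.val) ?_ ?_ ?_ ?_ ?_
    · simp
    · simp [ZMod.val_lt]
    · intro i hi; exact ZMod.val_cast_of_lt (Finset.mem_range.1 hi)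
    · simp
    · simp
  refine ⟨fun x => ∏ i ∈ Finset.range x.val, g ((i : ZMod L) + 1), by simp, fun x => ?_⟩
  obtain ⟨i, hi, rfl⟩ : ∃ i < (L : ℕ), (i : ZMod L) + 1 = x :=
    ⟨(x - 1).val, ZMod.val_lt _, by simp⟩
  dsimp only
  rw [add_sub_cancel_right, ZMod.val_cast_of_lt hi, ← Finset.prod_range_succ]
  -- The last step around the cycle returns to the empty product at zero, so the full product has to
  -- be one.
  by_cases h : i + 1 = L
  · rw [h, hprod, ← Nat.cast_succ, Nat.succ_eq_add_one, h]
    simp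
  · rw [← Nat.cast_succ, ZMod.val_cast_of_lt (by omega)]

theorem mul_mul_mul_eq_one {a b c d : ℤˣ} (h : a * b * c * d = 1) : c = d * (a * b) := by
  obtain rfl | rfl := Int.units_eq_one_or a <;> obtain rfl | rfl := Int.units_eq_one_or b <;>
  obtain rfl | rfl := Int.units_eq_one_or c <;> obtain rfl | rfl := Int.units_eq_one_or d <;>
  simp at h ⊢

/-- Multiply the vertex constraints along one line: links inside the line occur twice and cancel,
leaving the crossing links on its two sides. -/
theorem IsClosedConfig.lineZ_add_one {s : (links L).Config} (hs : IsClosedConfig s) (b : Bool)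
    (y : ZMod L) : lineZ b (y + 1) s = lineZ b y s := by
  cases b
  · have h : ∀ z, sg (s (true, (z, y + 1))) =
        sg (s (true, (z, y))) * (sg (s (false, (z, y + 1))) * sg (s (false, (z - 1, y + 1)))) :=
      fun z => by simpa using mul_mul_mul_eq_one (hs (z, y + 1))
    have h' : ∏ z, sg (s (false, (z - 1, y + 1))) = ∏ z, sg (s (false, (z, y + 1))) :=
      (Equiv.subRight (1 : ZMod L)).prod_comp fun z => sg (s (false, (z, y + 1)))
    simp only [lineZ, lineSite, Bool.not_false, Bool.false_eq_true, if_false]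
    simp only [h, Finset.prod_mul_distrib, h', Int.units_mul_self, mul_one]
  · have h : ∀ z, sg (s (false, (y + 1, z))) =
        sg (s (false, (y, z))) * (sg (s (true, (y + 1, z))) * sg (s (true, (y + 1, z - 1)))) :=
      fun z => by
        refine mul_mul_mul_eq_one ?_
        have := hs (y + 1, z)
        simp only [vertSign, add_sub_cancel_right] at this
        rw [← this]
        ac_rfl
    have h' : ∏ z, sg (s (true, (y + 1, z - 1))) = ∏ z, sg (s (true, (y + 1, z))) :=
      (Equiv.subRight (1 : ZMod L)).prod_comp fun z => sg (s (true, (y + 1, z)))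
    simp only [lineZ, lineSite, Bool.not_true, if_true]
    simp only [h, Finset.prod_mul_distrib, h', Int.units_mul_self, mul_one]

theorem IsClosedConfig.lineZ_eq {s : (links L).Config} (hs : IsClosedConfig s) (b : Bool)
    (y : ZMod L) : lineZ b y s = lineZ b 0 s :=
  eq_zero_of_step (fun y => lineZ b y s) (hs.lineZ_add_one b) y

/-- The set `F` is found by integration: first along the row at height zero (`a`), then up each
column (`c`). Trivial winding makes both integrations single-valued around the torus. -/
theorem IsClosedConfig.exists_bdry {s : (links L).Config} (hs : IsClosedConfig s)
    (hw : ∀ b, lineZ b 0 s = 1) : ∃ F, s = bdry F := by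
  obtain ⟨a, -, ha⟩ := exists_potential (fun x => sg (s (true, (x, 0)))) (hw false)
  have hcol : ∀ x, ∏ y, sg (s (false, (x, y))) = 1 := fun x => by
    rw [← hw true, ← hs.lineZ_eq true x]; rfl
  choose c hc0 hc using fun x => exists_potential (fun y => sg (s (false, (x, y)))) (hcol x)
  have hrow : ∀ x y, a x * c x y = a (x - 1) * c (x - 1) y * sg (s (true, (x, y))) := by
    intro x y
    suffices h : a x * c x y * (a (x - 1) * c (x - 1) y * sg (s (true, (x, y)))) = 1 by
      rw [← mul_one (a x * c x y), ← Int.units_mul_self (a (x - 1) * c (x - 1) y *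
        sg (s (true, (x, y)))), ← mul_assoc, h, one_mul]
    -- The defect of the row relation does not depend on the height, by the vertex constraint, and
    -- at height zero it is trivial by the choice of `a`.
    rw [eq_zero_of_step (fun y => a x * c x y * (a (x - 1) * c (x - 1) y * sg (s (true, (x, y)))))
      (fun y => ?_) y]
    · simp only [hc0, ha x, mul_one]
      exact Int.units_mul_self _
    · have h := mul_mul_mul_eq_one (hs (x, y + 1))
      simp only [add_sub_cancel_right] at h
      simp only [hc x (y + 1), hc (x - 1) (y + 1), add_sub_cancel_right, h]
      generalize sg (s (false, (x, y + 1))) = u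
      generalize sg (s (false, (x - 1, y + 1))) = v
      have hu := Int.units_mul_self u
      have hv := Int.units_mul_self v
      calc _ = a x * c x y * (a (x - 1) * c (x - 1) y * sg (s (true, (x, y)))) *
            ((u * u) * (v * v)) := by ac_rfl
        _ = _ := by rw [hu, hv, mul_one, mul_one]
  choose F hF using fun p : Site L => exists_sg_eq (a p.1 * c p.1 p.2)
  refine ⟨F, ?_⟩
  ext ⟨b, x, y⟩
  apply sg_injective
  cases b
  · simp only [bdry, sg_xor, hF, Bool.false_eq_true, if_false]
    rw [hc x y]
    calc _ = (a x * a x) * (c x (y - 1) * c x (y - 1)) * sg (s (false, (x, y))) := by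
          rw [Int.units_mul_self, Int.units_mul_self, one_mul, one_mul]
      _ = _ := by ac_rfl
  · simp only [bdry, sg_xor, hF, if_true]
    rw [hrow]
    calc _ = (a (x - 1) * c (x - 1) y) * (a (x - 1) * c (x - 1) y) * sg (s (true, (x, y))) := by
          rw [Int.units_mul_self, one_mul]
      _ = _ := by ac_rfl

theorem bdry_xor (F G : Site L → Bool) :
    bdry (fun p => xor (F p) (G p)) = xorC (bdry F) (bdry G) := by
  ext l
  have h : ∀ a b c d : Bool, xor (xor a b) (xor c d) = xor (xor a c) (xor b d) := by decide
  exact h _ _ _ _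

theorem bdry_invariant {β : Type*} (g : (links L).Config → β)
    (hg : ∀ x s, g (xorC s (bdry fun p => decide (p = x))) = g s) (F : Site L → Bool)
    (s : (links L).Config) : g (xorC s (bdry F)) = g s := by
  suffices h : ∀ A : Finset (Site L), g (xorC s (bdry fun p => decide (p ∈ A))) = g s by
    simpa using h (Finset.univ.filter fun p => F p = true)
  intro A
  induction A using Finset.induction_on with
  | empty =>
    congr 1
    ext l
    simp [bdry]
  | insert a A ha ih =>
    rw [← ih, ← hg a (xorC s (bdry fun p => decide (p ∈ A)))]
    congr 1
    have h : ∀ p, decide (p ∈ insert a A) = xor (decide (p ∈ A)) (decide (p = a)) := by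
      intro p
      by_cases h : p = a
      · subst h; simp [ha]
      · simp [h]
    simp only [h, bdry_xor]
    ext l
    simp

/-- Neighbouring loops bound the row of plaquettes between them, so loops can be moved freely on the
code space. -/
theorem xorC_lineX_add_one (b : Bool) (y : ZMod L) (s : (links L).Config) :
    xorC s (lineX b (y + 1)) =
      xorC (xorC s (lineX b y)) (bdry fun p => decide (coord b p = y)) := by
  ext ⟨b', p, q⟩
  cases b <;> cases b' <;> simp [lineX, bdry, coord, sub_eq_iff_eq_add]

theorem vertSign_xorC_lineX (x : Site L) (b : Bool) (s : (links L).Config) :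
    vertSign x (xorC s (lineX b 0)) = vertSign x s := by
  obtain ⟨x, y⟩ := x
  have h : ∀ u v a b c : ℤˣ, u * a * (v * a) * b * c = u * v * b * c := fun u v a b c => by
    calc _ = u * v * (a * a) * b * c := by ac_rfl
      _ = _ := by rw [Int.units_mul_self, mul_one]
  have h' : ∀ u v a b c : ℤˣ, b * c * (u * a) * (v * a) = b * c * u * v := fun u v a b c => by
    calc _ = b * c * u * v * (a * a) := by ac_rfl
      _ = _ := by rw [Int.units_mul_self, mul_one]
  cases b
  · simp [vertSign, sg_xor, lineX, coord, h]
  · simp [vertSign, sg_xor, lineX, coord, h']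

theorem lineZ_xorC_lineX_same (b : Bool) (s : (links L).Config) :
    lineZ b 0 (xorC s (lineX b 0)) = lineZ b 0 s := by
  simp [lineZ, lineX]

theorem lineZ_xorC_lineX_not (b : Bool) (s : (links L).Config) :
    lineZ b 0 (xorC s (lineX (!b) 0)) = -lineZ b 0 s := by
  have h : ∀ z : ZMod L, sg (lineX (!b) 0 (!b, lineSite b 0 z)) = if z = 0 then -1 else 1 := by
    intro z
    cases b <;> simp [lineX, lineSite, coord, sg]
  simp only [lineZ, xorC_apply, sg_xor, Finset.prod_mul_distrib, h]
  simp

/-! ### Irreducibility of the logical operators -/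

/-- Operators on the code space, extended by zero to its orthogonal complement. -/
def IsCodeOp (M : (links L).Op) : Prop := ∀ s, IsStab s → s * M = M ∧ M * s = M

theorem IsCodeOp.bdry_left {M : (links L).Op} (hM : IsCodeOp M) (F : Site L → Bool)
    (s t : (links L).Config) : M (xorC s (bdry F)) t = M s t := by
  refine bdry_invariant (fun s => M s t) (fun x s => ?_) F s
  conv_rhs => rw [← (hM _ ⟨x, Or.inl rfl⟩).1, plaquetteOp_eq, shiftOp_mul_apply]

theorem IsCodeOp.bdry_right {M : (links L).Op} (hM : IsCodeOp M) (F : Site L → Bool)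
    (s t : (links L).Config) : M s (xorC t (bdry F)) = M s t := by
  refine bdry_invariant (fun t => M s t) (fun x t => ?_) F t
  conv_rhs => rw [← (hM _ ⟨x, Or.inl rfl⟩).2, plaquetteOp_eq, mul_shiftOp_apply]

theorem eq_one_of_mul_eq {u : ℤˣ} {z : ℂ} (hz : z ≠ 0) (h : ((u : ℤ) : ℂ) * z = z) : u = 1 := by
  obtain rfl | rfl := Int.units_eq_one_or u
  · rfl
  · refine absurd h fun h => hz ?_
    simp only [Units.val_neg, Units.val_one, Int.cast_neg, Int.cast_one, neg_mul, one_mul] at h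
    linear_combination (-1 / 2 : ℂ) * h

theorem IsCodeOp.closed_left {M : (links L).Op} (hM : IsCodeOp M) {s t : (links L).Config}
    (h : M s t ≠ 0) : IsClosedConfig s := by
  intro x
  refine eq_one_of_mul_eq h ?_
  rw [← signOp_mul_apply, ← vertexOp_eq, (hM _ ⟨x, Or.inr rfl⟩).1]

theorem IsCodeOp.closed_right {M : (links L).Op} (hM : IsCodeOp M) {s t : (links L).Config}
    (h : M s t ≠ 0) : IsClosedConfig t := by
  intro x
  refine eq_one_of_mul_eq h ?_
  rw [mul_comm, ← mul_signOp_apply, ← vertexOp_eq, (hM _ ⟨x, Or.inr rfl⟩).2]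

/-- `M` commutes with the logical Pauli operators. -/
def CommutesWithLoops (M : (links L).Op) : Prop :=
  ∀ b, shiftOp (lineX b 0) * M = M * shiftOp (lineX b 0) ∧
    signOp (lineZ b 0) * M = M * signOp (lineZ b 0)

theorem CommutesWithLoops.shift {M : (links L).Op} (hM : CommutesWithLoops M) (b : Bool)
    (s t : (links L).Config) : M (xorC s (lineX b 0)) (xorC t (lineX b 0)) = M s t := by
  have h := congrFun (congrFun (hM b).1 s) (xorC t (lineX b 0))
  rwa [shiftOp_mul_apply, mul_shiftOp_apply, xorC_self_right] at h

open Classical in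
-- Stabilizers restrict `M` to closed configurations and make its entries depend only on homology
-- classes. The `Z` loops force both classes to agree, and the `X` loops carry each class to the
-- trivial one. A single free entry remains.
theorem IsCodeOp.apply_eq {M : (links L).Op} (hM : IsCodeOp M) (hc : CommutesWithLoops M)
    (s t : (links L).Config) : M s t =
      if IsClosedConfig s ∧ IsClosedConfig t ∧ ∀ b, lineZ b 0 s = lineZ b 0 t then
        M (fun _ => false) (fun _ => false) else 0 := by
  have h0 : ∀ F : Site L → Bool, bdry F = xorC (fun _ => false) (bdry F) := fun F => by
    ext l; simp
  have trivial_case : ∀ s t : (links L).Config, IsClosedConfig s → IsClosedConfig t →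
      (∀ b, lineZ b 0 s = 1) → (∀ b, lineZ b 0 t = 1) →
      M s t = M (fun _ => false) (fun _ => false) := by
    intro s t hs ht hs' ht'
    obtain ⟨F, rfl⟩ := hs.exists_bdry hs'
    obtain ⟨F', rfl⟩ := ht.exists_bdry ht'
    rw [h0 F, h0 F', hM.bdry_left, hM.bdry_right]
  have true_case : ∀ s t : (links L).Config, IsClosedConfig s → IsClosedConfig t →
      (∀ b, lineZ b 0 s = lineZ b 0 t) → lineZ true 0 s = 1 →
      M s t = M (fun _ => false) (fun _ => false) := by
    intro s t hs ht hw h1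
    rcases Int.units_eq_one_or (lineZ false 0 s) with h2 | h2
    · refine trivial_case s t hs ht ?_ ?_ <;> intro b <;> cases b <;> simp [← hw, h1, h2]
    -- Adding the `X` loop of direction `true` to both arguments flips `lineZ false` and keeps
    -- `lineZ true`.
    · rw [← hc.shift true]
      have e := lineZ_xorC_lineX_not (L := L) false
      rw [Bool.not_false] at e
      have e' := lineZ_xorC_lineX_same (L := L) true
      refine trivial_case _ _ (fun x => ?_) (fun x => ?_) ?_ ?_
      · rw [vertSign_xorC_lineX, hs x]
      · rw [vertSign_xorC_lineX, ht x]
      all_goals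
        intro b
        cases b
        · simp [e, ← hw, h2]
        · rw [e']
          first | exact h1 | rw [← hw, h1]
  split_ifs with h
  · obtain ⟨hs, ht, hw⟩ := h
    rcases Int.units_eq_one_or (lineZ true 0 s) with h1 | h1
    · exact true_case s t hs ht hw h1
    · rw [← hc.shift false]
      have e := lineZ_xorC_lineX_not (L := L) true
      rw [Bool.not_true] at e
      refine true_case _ _ (fun x => ?_) (fun x => ?_) ?_ ?_
      · rw [vertSign_xorC_lineX, hs x]
      · rw [vertSign_xorC_lineX, ht x]
      · intro b
        cases b
        · rw [lineZ_xorC_lineX_same, lineZ_xorC_lineX_same, hw]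
        · simp [e, hw]
      · simp [e, h1]
  · by_contra hne
    refine h ⟨hM.closed_left hne, hM.closed_right hne, fun b => ?_⟩
    have h1 := congrFun (congrFun (hc b).2 s) t
    rw [signOp_mul_apply, mul_signOp_apply, mul_comm] at h1
    have h2 := mul_left_cancel₀ hne h1
    exact_mod_cast h2

theorem IsCodeOp.eq_smul {M P : (links L).Op} (hM : IsCodeOp M) (hc : CommutesWithLoops M)
    (hP : IsCodeOp P) (hcP : CommutesWithLoops P) (hne : P ≠ 0) : ∃ c : ℂ, M = c • P := by
  have h0 : P (fun _ => false) (fun _ => false) ≠ 0 := by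
    intro h
    refine hne ?_
    ext s t
    rw [hP.apply_eq hcP, h]
    simp
  refine ⟨M (fun _ => false) (fun _ => false) / P (fun _ => false) (fun _ => false), ?_⟩
  ext s t
  rw [Matrix.smul_apply, hM.apply_eq hc s t, hP.apply_eq hcP s t]
  split_ifs
  · rw [smul_eq_mul, div_mul_cancel₀ _ h0]
  · simp

/-! ### The projection onto the code space -/

/-- Characterization of the orthogonal projection onto the code space. -/
structure IsCodeProj (P : (links L).Op) : Prop where
  conjTranspose : Pᴴ = P
  isCodeOp : IsCodeOp P
  mul_eq : ∀ M : (links L).Op, (∀ s, IsStab s → s * M = M) → P * M = M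
  mulVec_eq : ∀ v ∈ codeSpace L, P *ᵥ v = v

theorem exists_isCodeProj (L : ℕ+) : ∃ P : (links L).Op, IsCodeProj P := by
  classical
  -- The orthogonal projection is taken in `EuclideanSpace`, whose inner product is the standard one
  -- in the computational basis.
  let e := WithLp.linearEquiv 2 ℂ (links L).Vec
  let V : Submodule ℂ (EuclideanSpace ℂ (links L).Config) :=
    (codeSpace L).comap (e : _ →ₗ[ℂ] _)
  let p : EuclideanSpace ℂ (links L).Config →ₗ[ℂ] EuclideanSpace ℂ (links L).Config :=
    V.starProjection
  let P : (links L).Op := Matrix.toEuclideanLin.symm p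
  have hp : ∀ v : (links L).Vec, P *ᵥ v = WithLp.ofLp (p (WithLp.toLp 2 v)) := by
    intro v
    have : p = Matrix.toEuclideanLin P := by simp [P]
    rw [this]
    simp
  have hrange : ∀ v : (links L).Vec, P *ᵥ v ∈ codeSpace L := by
    intro v
    rw [hp]
    exact V.starProjection_apply_mem (WithLp.toLp 2 v)
  have hfix : ∀ v ∈ codeSpace L, P *ᵥ v = v := by
    intro v hv
    rw [hp]
    exact congrArg WithLp.ofLp (Submodule.starProjection_eq_self_iff.2
      (show WithLp.toLp 2 v ∈ V from hv))
  have hherm : Pᴴ = P := by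
    have h1 : LinearMap.IsSymmetric p := V.starProjection_isSymmetric
    have : p = Matrix.toEuclideanLin P := by simp [P]
    rw [this, Matrix.isSymmetric_toEuclideanLin_iff] at h1
    exact h1
  have hmul : ∀ M : (links L).Op, (∀ s, IsStab s → s * M = M) → P * M = M := by
    intro M hM
    refine Matrix.ext_of_mulVec_single fun i => ?_
    rw [← Matrix.mulVec_mulVec]
    refine hfix _ (mem_codeSpace_iff.2 fun s hs => ?_)
    rw [Matrix.mulVec_mulVec, hM s hs]
  have hsP : ∀ s, IsStab s → s * P = P := by
    intro s hs
    refine Matrix.ext_of_mulVec_single fun i => ?_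
    rw [← Matrix.mulVec_mulVec]
    exact mem_codeSpace_iff.1 (hrange _) s hs
  refine ⟨P, hherm, fun s hs => ⟨hsP s hs, ?_⟩, hmul, hfix⟩
  rw [← hherm, ← hs.conjTranspose, ← Matrix.conjTranspose_mul, hsP s hs]

theorem IsCodeOp.shiftOp_lineX_mul {P : (links L).Op} (hP : IsCodeOp P) (b : Bool) (y : ZMod L) :
    shiftOp (lineX b y) * P = shiftOp (lineX b 0) * P := by
  ext s t
  rw [shiftOp_mul_apply, shiftOp_mul_apply]
  refine eq_zero_of_step (fun y => P (xorC s (lineX b y)) t) (fun y => ?_) y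
  rw [xorC_lineX_add_one, hP.bdry_left]

theorem IsCodeOp.signOp_lineZ_mul {P : (links L).Op} (hP : IsCodeOp P) (b : Bool) (y : ZMod L) :
    signOp (lineZ b y) * P = signOp (lineZ b 0) * P := by
  ext s t
  rw [signOp_mul_apply, signOp_mul_apply]
  by_cases h : P s t = 0
  · rw [h, mul_zero, mul_zero]
  · rw [(hP.closed_left h).lineZ_eq]

/-! ### Matrix lemmas -/

theorem eq_zero_of_sum_conjTranspose_mul_self {m n κ : Type*} [Fintype m] [Fintype n] [Fintype κ]
    {X : κ → Matrix m n ℂ} (h : ∑ k, (X k)ᴴ * X k = 0) (k : κ) : X k = 0 := by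
  have h1 : ∑ k, ((X k)ᴴ * X k).trace = 0 := by rw [← Matrix.trace_sum, h, Matrix.trace_zero]
  rw [Finset.sum_eq_zero_iff_of_nonneg fun k _ =>
    (Matrix.posSemidef_conjTranspose_mul_self (X k)).trace_nonneg] at h1
  exact Matrix.trace_conjTranspose_mul_self_eq_zero_iff.1 (h1 k (Finset.mem_univ k))

/-- Rescaling one nonzero `A k₀` gives `u` with `u uᴴ = P`, and a trace count gives `uᴴ u = P`. Then
`A k = A k uᴴ u` is a multiple of `P u = u`. The squared moduli of the coefficients sum to one by
`hsum`, and adding `1 - P` makes `u` unitary. -/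
theorem exists_unitary_of_kraus {n κ : Type*} [Fintype n] [DecidableEq n] [Fintype κ]
    {P : Matrix n n ℂ} {A : κ → Matrix n n ℂ} (hPH : Pᴴ = P) (hPP : P * P = P) (hP0 : P ≠ 0)
    (hPA : ∀ k, P * A k = A k) (hAP : ∀ k, A k * P = A k) (hsum : ∑ k, (A k)ᴴ * A k = P)
    (hAA : ∀ k l, ∃ c : ℂ, A k * (A l)ᴴ = c • P) :
    ∃ U ∈ Matrix.unitaryGroup n ℂ, P * (U * P) = U * P ∧
      ∀ ρ, ∑ k, A k * ρ * (A k)ᴴ = U * (P * ρ * P) * Uᴴ := by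
  obtain ⟨k₀, hk₀⟩ : ∃ k, A k ≠ 0 := by
    by_contra! h
    exact hP0 (by rw [← hsum]; simp [h])
  obtain ⟨c, hc⟩ := hAA k₀ k₀
  have htP : P.trace ≠ 0 := by
    rw [← hPP]
    nth_rw 1 [← hPH]
    exact fun h => hP0 (Matrix.trace_conjTranspose_mul_self_eq_zero_iff.1 h)
  have htP0 : 0 ≤ P.trace := by
    rw [← hPP]
    nth_rw 1 [← hPH]
    exact (Matrix.posSemidef_conjTranspose_mul_self P).trace_nonneg
  have hcne : c ≠ 0 := by
    rintro rfl
    rw [zero_smul] at hc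
    exact hk₀ (Matrix.self_mul_conjTranspose_eq_zero.1 hc)
  have hc0 : 0 ≤ c := by
    have h1 : c = (A k₀ * (A k₀)ᴴ).trace * P.trace⁻¹ := by
      rw [hc, Matrix.trace_smul, smul_eq_mul, mul_assoc, mul_inv_cancel₀ htP, mul_one]
    rw [h1]
    exact mul_nonneg (Matrix.posSemidef_self_mul_conjTranspose _).trace_nonneg
      (inv_nonneg.2 htP0)
  obtain ⟨x, hx, rfl⟩ : ∃ x : ℝ, 0 ≤ x ∧ (x : ℂ) = c :=
    ⟨c.re, (Complex.le_def.1 hc0).1,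
      (Complex.eq_re_of_ofReal_le (r := 0) (by simpa using hc0)).symm⟩
  have hx0 : (x : ℂ) ≠ 0 := hcne
  have hsq : ((Real.sqrt x : ℝ) : ℂ) * ((Real.sqrt x : ℝ) : ℂ) = x := by
    rw [← Complex.ofReal_mul, Real.mul_self_sqrt hx]
  have hs0 : ((Real.sqrt x : ℝ) : ℂ) ≠ 0 := fun h => hx0 (by rw [← hsq, h, zero_mul])
  generalize ha : ((Real.sqrt x : ℝ) : ℂ)⁻¹ = a
  have hastar : star a = a := by rw [← ha, star_inv₀]; simp
  have haa : a * a * x = 1 := by rw [← ha, ← hsq]; field_simp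
  obtain ⟨u, hu⟩ : ∃ u, u = a • A k₀ := ⟨_, rfl⟩
  have huH : uᴴ = a • (A k₀)ᴴ := by rw [hu, Matrix.conjTranspose_smul, hastar]
  have huu : u * uᴴ = P := by
    rw [huH, hu, Matrix.smul_mul, Matrix.mul_smul, hc, smul_smul, smul_smul, haa, one_smul]
  have hPu : P * u = u := by rw [hu, Matrix.mul_smul, hPA]
  have huP : u * P = u := by rw [hu, Matrix.smul_mul, hAP]
  have hPuH : P * uᴴ = uᴴ := by
    conv_rhs => rw [← huP, Matrix.conjTranspose_mul, hPH]
  have huHu : uᴴ * u = P := by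
    have hEE : uᴴ * u * (uᴴ * u) = uᴴ * u := by
      rw [mul_assoc, ← mul_assoc u, huu, hPu]
    have hPE : P * (uᴴ * u) = uᴴ * u := by rw [← mul_assoc, hPuH]
    have hEP : uᴴ * u * P = uᴴ * u := by rw [mul_assoc, huP]
    -- The difference is itself an orthogonal projection, so its vanishing trace makes it zero.
    have h1 : (P - uᴴ * u)ᴴ * (P - uᴴ * u) = P - uᴴ * u := by
      rw [Matrix.conjTranspose_sub, hPH, Matrix.conjTranspose_mul, Matrix.conjTranspose_conjTranspose,
        sub_mul, mul_sub, mul_sub, hPP, hPE, hEP, hEE, sub_self, sub_zero]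
    have h2 : (P - uᴴ * u).trace = 0 := by
      rw [Matrix.trace_sub, Matrix.trace_mul_comm, huu, sub_self]
    rw [← h1] at h2
    exact (sub_eq_zero.1 (Matrix.trace_conjTranspose_mul_self_eq_zero_iff.1 h2)).symm
  have hAu : ∀ k, ∃ b : ℂ, A k = b • u := by
    intro k
    obtain ⟨d, hd⟩ := hAA k k₀
    refine ⟨a * d, ?_⟩
    calc A k = A k * (uᴴ * u) := by rw [huHu, hAP]
      _ = _ := by
        rw [← mul_assoc, huH, Matrix.mul_smul, hd, smul_smul, Matrix.smul_mul, hPu]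
  choose b hb using hAu
  have hbsum : ∑ k, star (b k) * b k = 1 := by
    have h1 : (∑ k, star (b k) * b k) • P = (1 : ℂ) • P := by
      conv_rhs => rw [one_smul, ← hsum]
      rw [Finset.sum_smul]
      refine Finset.sum_congr rfl fun k _ => ?_
      rw [hb k, Matrix.conjTranspose_smul, Matrix.smul_mul, Matrix.mul_smul, smul_smul, huHu]
    exact smul_left_injective ℂ hP0 h1
  have hUP : (u + (1 - P)) * P = u := by
    rw [add_mul, huP, sub_mul, one_mul, hPP, sub_self, add_zero]
  refine ⟨u + (1 - P), Matrix.mem_unitaryGroup_iff.2 ?_, by rw [hUP, hPu], fun ρ => ?_⟩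
  · rw [Matrix.star_eq_conjTranspose, Matrix.conjTranspose_add, Matrix.conjTranspose_sub,
      Matrix.conjTranspose_one, hPH, add_mul, mul_add, mul_add, huu, mul_sub, mul_one, huP,
      sub_self, sub_mul, one_mul, hPuH, sub_self, mul_sub, mul_one, sub_mul, one_mul, hPP]
    abel
  · have h1 : (u + (1 - P)) * (P * ρ * P) * (u + (1 - P))ᴴ =
        ((u + (1 - P)) * P) * ρ * ((u + (1 - P)) * P)ᴴ := by
      rw [Matrix.conjTranspose_mul, hPH]
      simp only [mul_assoc]
    rw [h1, hUP]
    calc ∑ k, A k * ρ * (A k)ᴴ = ∑ k, (star (b k) * b k) • (u * ρ * uᴴ) := by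
          refine Finset.sum_congr rfl fun k _ => ?_
          rw [hb k, Matrix.conjTranspose_smul, Matrix.smul_mul, Matrix.smul_mul, Matrix.mul_smul,
            smul_smul, mul_comm]
      _ = _ := by rw [← Finset.sum_smul, hbsum, one_smul]

/-! ### Duality and intertwining defects of Kraus operators -/

section Kraus

variable {Q Q' : Register L} {κ : Type} [Fintype κ]

theorem heis_conjTranspose (K : κ → Matrix Q'.Config Q.Config ℂ) (O : Q'.Op) :
    (heis K O)ᴴ = heis K Oᴴ := by
  simp [heis, Matrix.conjTranspose_sum, Matrix.conjTranspose_mul, Matrix.mul_assoc]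

theorem trace_heis_mul (K : κ → Matrix Q'.Config Q.Config ℂ) (O : Q'.Op) (ρ : Q.Op) :
    (heis K O * ρ).trace = (O * ∑ k, K k * ρ * (K k)ᴴ).trace := by
  simp only [heis, Matrix.sum_mul, Matrix.mul_sum, Matrix.trace_sum]
  refine Finset.sum_congr rfl fun k _ => ?_
  rw [Matrix.mul_assoc, Matrix.mul_assoc, Matrix.trace_mul_comm]
  simp only [Matrix.mul_assoc]

/-- The total squared defect of the intertwining relation `A K P = K T P`. -/
theorem sum_defect {K : κ → Matrix Q'.Config Q.Config ℂ} (hK : ∑ k, (K k)ᴴ * K k = 1)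
    {P T : Q.Op} {A : Q'.Op} (hP : Pᴴ = P) (hPP : P * P = P) (hT : Tᴴ = T) (hA : Aᴴ = A)
    (hAA : A * A = 1) :
    ∑ k, (A * (K k * P) - K k * (T * P))ᴴ * (A * (K k * P) - K k * (T * P)) =
      P - P * (heis K A * T) * P - P * (T * heis K A) * P + P * (T * T) * P := by
  have h1 : ∀ k, (A * (K k * P) - K k * (T * P))ᴴ * (A * (K k * P) - K k * (T * P)) =
      P * ((K k)ᴴ * K k) * P - P * ((K k)ᴴ * A * K k * T) * P - P * (T * ((K k)ᴴ * A * K k)) * P +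
        P * (T * ((K k)ᴴ * K k) * T) * P := by
    intro k
    have hAA' : ∀ X : Matrix Q'.Config Q.Config ℂ, A * (A * X) = X := fun X => by
      rw [← Matrix.mul_assoc, hAA, Matrix.one_mul]
    simp only [Matrix.conjTranspose_sub, Matrix.conjTranspose_mul, hP, hT, hA, Matrix.sub_mul,
      Matrix.mul_sub, Matrix.mul_assoc, hAA']
    abel
  have h2 : ∑ k, P * ((K k)ᴴ * K k) * P = P := by
    rw [← Matrix.sum_mul, ← Matrix.mul_sum, hK, mul_one, hPP]
  have h3 : T * T = T * (∑ k, (K k)ᴴ * K k) * T := by rw [hK, mul_one]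
  simp only [h1, Finset.sum_add_distrib, Finset.sum_sub_distrib]
  rw [h2, h3]
  simp only [heis, Matrix.sum_mul, Matrix.mul_sum]

end Kraus

/-! ### Families of parallel loops -/

/-- Parallel loop operators that act in the same way on the code space. -/
structure IsLoopFamily (P : (links L).Op) (b : Bool) (W : ZMod L → (links L).Op) : Prop where
  conjTranspose : ∀ y, (W y)ᴴ = W y
  mul_self : ∀ y, W y * W y = 1
  siteLocal : ∀ y, SiteLocal (strip b y 0) (W y)
  mul_proj : ∀ y, W y * P = W 0 * P

theorem IsCodeProj.isLoopFamily_X {P : (links L).Op} (hP : IsCodeProj P) (b : Bool) :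
    IsLoopFamily P b fun y => shiftOp (lineX b y) :=
  ⟨fun _ => shiftOp_conjTranspose _, fun _ => shiftOp_mul_self _, siteLocal_shiftOp_lineX b,
    hP.isCodeOp.shiftOp_lineX_mul b⟩

theorem IsCodeProj.isLoopFamily_Z {P : (links L).Op} (hP : IsCodeProj P) (b : Bool) :
    IsLoopFamily P b fun y => signOp (lineZ b y) :=
  ⟨fun _ => signOp_conjTranspose _, fun _ => signOp_mul_self _, siteLocal_signOp_lineZ b,
    hP.isCodeOp.signOp_lineZ_mul b⟩

theorem IsCodeProj.mul_self {P : (links L).Op} (hP : IsCodeProj P) : P * P = P :=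
  hP.mul_eq P fun s hs => (hP.isCodeOp s hs).1

theorem IsCodeProj.isCodeOp_sandwich {P : (links L).Op} (hP : IsCodeProj P) (O : (links L).Op) :
    IsCodeOp (P * O * P) := fun s hs => by
  refine ⟨?_, ?_⟩
  · rw [← mul_assoc, ← mul_assoc, (hP.isCodeOp s hs).1]
  · rw [mul_assoc, (hP.isCodeOp s hs).2]

/-- A stabilizer reaches distance one from its centre, so the bound `2 * ρ + 2` leaves it disjoint
from at least one of the two strips. It commutes with that representative of the common action on
the code space, hence `T` preserves the code space. Hermiticity turns this into commutation with
`P`. -/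
theorem IsCodeProj.commute_of_far {P T T' : (links L).Op} (hP : IsCodeProj P) {b : Bool}
    {y z : ZMod L} {ρ : ℕ} (hT : SiteLocal (strip b y ρ) T) (hT' : SiteLocal (strip b z ρ) T')
    (hTT' : T * P = T' * P) (hTH : Tᴴ = T) (hyz : 2 * ρ + 2 < cycDist y z) : T * P = P * T := by
  have h1 : P * (T * P) = T * P := by
    refine hP.mul_eq _ fun s hs => ?_
    obtain ⟨x, hx⟩ := hs.siteLocal
    have hd := cycDist_triangle y (coord b x) z
    rw [cycDist_comm y (coord b x)] at hd
    by_cases h : 1 + ρ < cycDist (coord b x) y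
    · rw [← mul_assoc, (hx b).commute hT (strip_disjoint h), mul_assoc, (hP.isCodeOp s hs).1]
    · have h' : 1 + ρ < cycDist (coord b x) z := by omega
      rw [hTT', ← mul_assoc, (hx b).commute hT' (strip_disjoint h'), mul_assoc,
        (hP.isCodeOp s hs).1]
  have h2 := congrArg Matrix.conjTranspose h1
  simp only [Matrix.conjTranspose_mul, hP.conjTranspose, hTH] at h2
  rw [← h1, ← h2, mul_assoc]

theorem IsLoopFamily.commute_proj {P : (links L).Op} (hP : IsCodeProj P) {b : Bool}
    {W : ZMod L → (links L).Op} (hW : IsLoopFamily P b W) (hL : 6 ≤ (L : ℕ)) (y : ZMod L) :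
    W y * P = P * W y := by
  -- For strips of width zero, distance three is the least that suffices; `6 ≤ L` makes it
  -- available.
  refine hP.commute_of_far (ρ := 0) (hW.siteLocal y) (hW.siteLocal (y + ((3 : ℕ) : ZMod L)))
    ?_ (hW.conjTranspose y) ?_
  · rw [hW.mul_proj, ← hW.mul_proj (y + ((3 : ℕ) : ZMod L))]
  · rw [cycDist_comm, cycDist_add_natCast y (by omega)]
    omega

theorem IsLoopFamily.commute_sandwich {P : (links L).Op} (hP : IsCodeProj P) {b : Bool}
    {W : ZMod L → (links L).Op} (hW : IsLoopFamily P b W) (hL : 6 ≤ (L : ℕ)) {y : ZMod L}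
    {ρ : ℕ} {O : (links L).Op} (hO : SiteLocal (strip b y ρ) O) (hρ : 2 * (ρ + 1) ≤ (L : ℕ)) :
    W 0 * (P * O * P) = P * O * P * W 0 := by
  -- The loop is moved just outside the support of `O`, passed through `O`, and moved back.
  set z := y + ((ρ + 1 : ℕ) : ZMod L) with hz
  have hc : W z * O = O * W z := by
    refine (hW.siteLocal z).commute hO (strip_disjoint ?_)
    rw [hz, cycDist_add_natCast y hρ]
    omega
  calc W 0 * (P * O * P) = W 0 * P * O * P := by simp only [mul_assoc]
    _ = P * (W z * O) * P := by
      rw [← hW.mul_proj z, hW.commute_proj hP hL z]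
      simp only [mul_assoc]
    _ = P * O * (W z * P) := by rw [hc]; simp only [mul_assoc]
    _ = P * O * P * W 0 := by
      rw [hW.mul_proj, hW.commute_proj hP hL]
      simp only [mul_assoc]

theorem IsCodeProj.commutesWithLoops {P : (links L).Op} (hP : IsCodeProj P) (hL : 6 ≤ (L : ℕ)) :
    CommutesWithLoops P :=
  fun b => ⟨(hP.isLoopFamily_X b).commute_proj hP hL 0, (hP.isLoopFamily_Z b).commute_proj hP hL 0⟩

/-- Local indistinguishability: local operators act as scalars on the code space. -/
theorem IsCodeProj.sandwich_eq_smul {P : (links L).Op} (hP : IsCodeProj P) (hP0 : P ≠ 0)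
    (hL : 6 ≤ (L : ℕ)) {x : Site L} {ρ : ℕ} {O : (links L).Op}
    (hO : ∀ b, SiteLocal (strip b (coord b x) ρ) O) (hρ : 2 * (ρ + 1) ≤ (L : ℕ)) :
    ∃ c : ℂ, P * O * P = c • P :=
  (hP.isCodeOp_sandwich O).eq_smul
    (fun b => ⟨(hP.isLoopFamily_X b).commute_sandwich hP hL (hO b) hρ,
      (hP.isLoopFamily_Z b).commute_sandwich hP hL (hO b) hρ⟩)
    hP.isCodeOp (hP.commutesWithLoops hL) hP0

theorem IsCodeProj.mul_ketBra {P : (links L).Op} (hP : IsCodeProj P) {φ : (links L).Vec}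
    (hφ : φ ∈ codeSpace L) : P * ketBra φ * P = ketBra φ := by
  have h1 : P * ketBra φ = ketBra φ := by
    rw [ketBra, Matrix.mul_vecMulVec, hP.mulVec_eq φ hφ]
  have h2 : (ketBra φ)ᴴ = ketBra φ := by
    rw [ketBra, Matrix.conjTranspose_vecMulVec, star_star]
  rw [h1]
  have h3 := congrArg Matrix.conjTranspose h1
  rwa [Matrix.conjTranspose_mul, h2, hP.conjTranspose] at h3

theorem trace_ketBra {φ : (links L).Vec} (hφ : IsUnitVector φ) : (ketBra φ).trace = 1 := by
  rw [ketBra, Matrix.trace_vecMulVec, dotProduct_comm]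
  exact hφ

/-! ### Local channels that return a code state to the code space -/

variable {κ : Type} [Fintype κ] {r : ℕ} {Φ : (links L).Op →ₗ[ℂ] (links L).Op}
  {K : κ → Matrix (links L).Config (links L).Config ℂ} {P : (links L).Op}

/-- Local indistinguishability makes the expectation of `heis K s` the same in every code state, so
its value one at `ψ` holds on the whole code space. With `T = 1` the total defect is then `P - P - P
+ P`. -/
theorem IsLocalKraus.stab_mul (h : IsLocalKraus r Φ K) (hP : IsCodeProj P)
    (hL : 4 * r + 12 ≤ (L : ℕ)) {ψ : (links L).Vec} (hψ : ψ ∈ codeSpace L)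
    (hψ1 : IsUnitVector ψ) (hsupp : SuppIn (Φ (ketBra ψ)) (codeSpace L)) (hP0 : P ≠ 0)
    {s : (links L).Op} (hs : IsStab s) (k : κ) : s * (K k * P) = K k * P := by
  obtain ⟨x, hx⟩ := hs.siteLocal
  obtain ⟨c, hc⟩ := hP.sandwich_eq_smul hP0 (by omega)
    (fun b => (h.siteLocal _ _ (hx b)).mono (thick_strip b _ _ _)) (by omega)
  have hc1 : c = 1 := by
    have h1 : s * Φ (ketBra ψ) = Φ (ketBra ψ) := by
      refine Matrix.ext_of_mulVec_single fun i => ?_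
      rw [← Matrix.mulVec_mulVec]
      exact mem_codeSpace_iff.1 (hsupp _) s hs
    have h2 : (heis K s * ketBra ψ).trace = 1 := by
      rw [trace_heis_mul, ← h.apply, h1, h.apply, ← one_mul (∑ k, _), ← trace_heis_mul, heis_one,
        h.norm, one_mul, trace_ketBra hψ1]
    have h3 : (P * heis K s * P * ketBra ψ).trace = (heis K s * (P * ketBra ψ * P)).trace := by
      rw [mul_assoc, mul_assoc, Matrix.trace_mul_comm]
      simp only [mul_assoc]
    rw [hP.mul_ketBra hψ, h2, hc, Matrix.smul_mul, Matrix.trace_smul, ← hP.mul_ketBra hψ,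
      ← mul_assoc, ← mul_assoc, hP.mul_self, hP.mul_ketBra hψ, trace_ketBra hψ1, smul_eq_mul,
      mul_one] at h3
    exact h3
  have h1 := sum_defect h.norm hP.conjTranspose hP.mul_self Matrix.conjTranspose_one
    hs.conjTranspose hs.mul_self
  simp only [mul_one, one_mul, hc, hc1, one_smul, hP.mul_self, sub_self, zero_sub,
    neg_add_cancel] at h1
  exact sub_eq_zero.1 (eq_zero_of_sum_conjTranspose_mul_self h1 k)

/-- Put `T = heis K (W z)`. The total defects for `W y` and `W z` are `P T² P - P` and `P - P T² P`.
Both are sums of positive terms and they cancel, so every term vanishes. -/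
theorem IsLocalKraus.loop_mul (h : IsLocalKraus r Φ K) (hP : IsCodeProj P)
    (hPK : ∀ k, P * (K k * P) = K k * P) {b : Bool} {W : ZMod L → (links L).Op}
    (hW : IsLoopFamily P b W) {y z : ZMod L} (hyz : 2 * r + 2 < cycDist y z) (k : κ) :
    W y * (K k * P) = K k * (heis K (W z) * P) ∧ W z * (K k * P) = K k * (heis K (W z) * P) := by
  have hT : (heis K (W z))ᴴ = heis K (W z) := by rw [heis_conjTranspose, hW.conjTranspose]
  -- The product of two parallel loops is the identity on the code space, which contains the image
  -- of each `K k * P`.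
  have key : ∀ y z, 2 * r + 2 < cycDist y z → P * (heis K (W y) * heis K (W z)) * P = P := by
    intro y z hyz
    have hd : Disjoint (thick r (strip b y 0)) (thick r (strip b z 0)) :=
      (strip_disjoint (by omega)).mono (thick_strip _ _ _ _) (thick_strip _ _ _ _)
    rw [← h.mul _ _ _ _ (hW.siteLocal y) (hW.siteLocal z) hd]
    have h1 : ∀ k, W y * W z * (K k * P) = K k * P := by
      intro k
      have hWW : W y * W z * P = P := by
        rw [mul_assoc, hW.mul_proj z, ← hW.mul_proj y, ← mul_assoc, hW.mul_self, one_mul]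
      rw [← hPK k, ← mul_assoc, hWW]
    calc P * heis K (W y * W z) * P = ∑ k, P * (K k)ᴴ * (W y * W z * (K k * P)) := by
          simp only [heis, Matrix.mul_sum, Matrix.sum_mul, mul_assoc]
      _ = P * (∑ k, (K k)ᴴ * K k) * P := by
          simp only [h1, Matrix.mul_sum, Matrix.sum_mul, mul_assoc]
      _ = P := by rw [h.norm, mul_one, hP.mul_self]
  have e1 := sum_defect h.norm hP.conjTranspose hP.mul_self hT (hW.conjTranspose y) (hW.mul_self y)
  have e2 := sum_defect h.norm hP.conjTranspose hP.mul_self hT (hW.conjTranspose z) (hW.mul_self z)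
  rw [key y z hyz, key z y (by rwa [cycDist_comm])] at e1
  have hsum := Fintype.sum_sum_type fun j : κ ⊕ κ =>
    (Sum.elim (fun k => W y * (K k * P) - K k * (heis K (W z) * P))
      (fun k => W z * (K k * P) - K k * (heis K (W z) * P)) j)ᴴ *
    (Sum.elim (fun k => W y * (K k * P) - K k * (heis K (W z) * P))
      (fun k => W z * (K k * P) - K k * (heis K (W z) * P)) j)
  simp only [Sum.elim_inl, Sum.elim_inr] at hsum
  rw [e1, e2] at hsum
  have h0 := eq_zero_of_sum_conjTranspose_mul_self (hsum.trans (by abel))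
  exact ⟨sub_eq_zero.1 (h0 (Sum.inl k)), sub_eq_zero.1 (h0 (Sum.inr k))⟩

/-- The intertwining relation alone gives `K k * (T * P)`. To place `T` to the right of `P`, it must
commute with `P`; this follows from a second, distant loop with the same pullback on the code space.
-/
theorem IsLocalKraus.exists_pullback (h : IsLocalKraus r Φ K) (hP : IsCodeProj P)
    (hL : 4 * r + 12 ≤ (L : ℕ)) (hPK : ∀ k, P * (K k * P) = K k * P) {b : Bool}
    {W : ZMod L → (links L).Op} (hW : IsLoopFamily P b W) :
    ∃ T : (links L).Op, Tᴴ = T ∧ ∀ k, W 0 * (K k * P) = K k * P * T := by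
  -- The least distance above `2 * r + 2`; it needs `4 * r + 6 ≤ L`.
  set z : ZMod L := 0 + ((2 * r + 3 : ℕ) : ZMod L) with hz
  have hd : 2 * r + 2 < cycDist z 0 := by
    rw [hz, cycDist_add_natCast 0 (by omega)]
    omega
  have hT : ∀ y, (heis K (W y))ᴴ = heis K (W y) := fun y => by
    rw [heis_conjTranspose, hW.conjTranspose]
  have hloc : ∀ y, SiteLocal (strip b y r) (heis K (W y)) := fun y =>
    (h.siteLocal _ _ (hW.siteLocal y)).mono ((thick_strip _ _ _ _).trans (by rw [zero_add]))
  have h1 := fun k => h.loop_mul hP hPK hW hd k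
  have h2 := fun k => h.loop_mul hP hPK hW (y := 0) (z := z) (by rwa [cycDist_comm]) k
  have hTT : heis K (W 0) * P = heis K (W z) * P := by
    calc heis K (W 0) * P = ∑ k, (K k)ᴴ * (K k * (heis K (W 0) * P)) := by
          simp only [← mul_assoc, ← Matrix.sum_mul, h.norm, one_mul]
      _ = ∑ k, (K k)ᴴ * (K k * (heis K (W z) * P)) := by
          refine Finset.sum_congr rfl fun k _ => ?_
          rw [← (h1 k).2, ← (h2 k).1]
      _ = _ := by simp only [← mul_assoc, ← Matrix.sum_mul, h.norm, one_mul]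
  have hc := hP.commute_of_far (hloc 0) (hloc z) hTT (hT 0) (by rwa [cycDist_comm])
  exact ⟨heis K (W 0), hT 0, fun k => by rw [(h1 k).2, hc, mul_assoc]⟩

/-- A local channel that returns one code state to the code space acts on the code space as a
logical unitary. -/
theorem IsLocalKraus.exists_logicalUnitary (h : IsLocalKraus r Φ K)
    (hL : 4 * r + 12 ≤ (L : ℕ)) {ψ : (links L).Vec} (hψ : ψ ∈ codeSpace L)
    (hψ1 : IsUnitVector ψ) (hsupp : SuppIn (Φ (ketBra ψ)) (codeSpace L)) :
    ∃ U : (links L).Op, IsLogicalUnitary U ∧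
      ∀ φ ∈ codeSpace L, Φ (ketBra φ) = U * ketBra φ * Uᴴ := by
  obtain ⟨P, hP⟩ := exists_isCodeProj L
  have hP0 : P ≠ 0 := by
    rintro rfl
    have h1 := trace_ketBra hψ1
    rw [← hP.mul_ketBra hψ] at h1
    simp at h1
  have hsK := fun (s : (links L).Op) (hs : IsStab s) k =>
    h.stab_mul hP hL hψ hψ1 hsupp hP0 hs k
  have hPK : ∀ k, P * (K k * P) = K k * P := fun k => hP.mul_eq _ fun s hs => hsK s hs k
  -- The same Hermitian `T` serves all Kraus operators: it moves the loop through `K k * P` and out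
  -- again through the adjoint of `K l * P`.
  have hcomm : ∀ {b : Bool} {W : ZMod L → (links L).Op}, IsLoopFamily P b W → ∀ k l,
      W 0 * ((K k * P) * (K l * P)ᴴ) = (K k * P) * (K l * P)ᴴ * W 0 := by
    intro b W hW k l
    obtain ⟨T, hT, hWT⟩ := h.exists_pullback hP hL hPK hW
    have h1 := congrArg Matrix.conjTranspose (hWT l)
    rw [Matrix.conjTranspose_mul, Matrix.conjTranspose_mul (K l * P), hT,
      hW.conjTranspose] at h1
    rw [← mul_assoc, hWT k, mul_assoc (K k * P), ← h1, ← mul_assoc]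
  have hcode : ∀ k l, IsCodeOp ((K k * P) * (K l * P)ᴴ) := by
    intro k l s hs
    refine ⟨by rw [← mul_assoc, hsK s hs], ?_⟩
    have h1 := congrArg Matrix.conjTranspose (hsK s hs l)
    rw [Matrix.conjTranspose_mul, hs.conjTranspose] at h1
    rw [mul_assoc, h1]
  obtain ⟨U, hU, hPU, hUρ⟩ := exists_unitary_of_kraus (A := fun k => K k * P) hP.conjTranspose
    hP.mul_self hP0 hPK (fun k => by rw [mul_assoc, hP.mul_self])
    (by
      calc ∑ k, (K k * P)ᴴ * (K k * P) = P * (∑ k, (K k)ᴴ * K k) * P := by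
            simp only [Matrix.conjTranspose_mul, hP.conjTranspose, Matrix.mul_sum, Matrix.sum_mul,
              mul_assoc]
        _ = P := by rw [h.norm, mul_one, hP.mul_self])
    (fun k l => (hcode k l).eq_smul
      (fun b => ⟨hcomm (hP.isLoopFamily_X b) k l, hcomm (hP.isLoopFamily_Z b) k l⟩) hP.isCodeOp
      (hP.commutesWithLoops (by omega)) hP0)
  refine ⟨U, ⟨hU, fun v hv => mem_codeSpace_iff.2 fun s hs => ?_⟩, fun φ hφ => ?_⟩
  · have h1 : U *ᵥ v = (P * (U * P)) *ᵥ v := by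
      rw [hPU, ← Matrix.mulVec_mulVec, hP.mulVec_eq v hv]
    rw [h1, Matrix.mulVec_mulVec, ← mul_assoc, (hP.isCodeOp s hs).1]
  · rw [← hP.mul_ketBra hφ, ← hUρ, h.apply]
    refine Finset.sum_congr rfl fun k _ => ?_
    simp only [Matrix.conjTranspose_mul, hP.conjTranspose, mul_assoc]

/-! ### Recovery in the thermodynamic limit -/

theorem IsChannel.conjBy_comp {Q Q' : Register L} {Φ : Q.Op →ₗ[ℂ] Q'.Op} (h : IsChannel Φ)
    {V : Q'.Op} (hV : Vᴴ * V = 1) : IsChannel (conjBy V ∘ₗ Φ) := by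
  obtain ⟨n, K, hK, hΦ⟩ := h
  refine ⟨n, fun k => V * K k, ?_, fun ρ => ?_⟩
  · rw [← hK]
    refine Finset.sum_congr rfl fun k _ => ?_
    rw [Matrix.conjTranspose_mul, Matrix.mul_assoc, ← Matrix.mul_assoc Vᴴ, hV, Matrix.one_mul]
  · change V * Φ ρ * Vᴴ = _
    rw [hΦ]
    simp only [Matrix.conjTranspose_mul, Matrix.mul_sum, Matrix.sum_mul, Matrix.mul_assoc]

theorem eventually_range_le {r r' : ℕ+ → ℕ}
    (hr : Tendsto (fun L : ℕ+ => (r L : ℝ) / (L : ℝ)) atTop (𝓝 0))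
    (hr' : Tendsto (fun L : ℕ+ => (r' L : ℝ) / (L : ℝ)) atTop (𝓝 0)) :
    ∀ᶠ L : ℕ+ in atTop, 4 * (r L + r' L) + 12 ≤ (L : ℕ) := by
  -- Ranges below `L / 16` give `4 * (r + r') < L / 2`, and `24 ≤ L` gives `12 ≤ L / 2`.
  filter_upwards [hr.eventually_lt_const (show (0 : ℝ) < 1 / 16 by norm_num),
    hr'.eventually_lt_const (show (0 : ℝ) < 1 / 16 by norm_num),
    eventually_ge_atTop (24 : ℕ+)] with L h1 h2 h3
  have hL : (0 : ℝ) < (L : ℕ) := by exact_mod_cast L.pos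
  rw [div_lt_iff₀ hL] at h1 h2
  have h3' : 24 ≤ (L : ℕ) := h3
  have h4 : (16 * (r L + r' L) : ℝ) < 2 * (L : ℕ) := by linarith
  have h5 : 16 * (r L + r' L) < 2 * (L : ℕ) := by exact_mod_cast h4
  omega

theorem eventually_exists_recovery {Q : ∀ L : ℕ+, Register L} {ψ : ∀ L : ℕ+, (links L).Vec}
    (hψ : ∀ L, ψ L ∈ codeSpace L ∧ IsUnitVector (ψ L))
    {N : ∀ L : ℕ+, (links L).Op →ₗ[ℂ] (Q L).Op} (hN : IsLCFamily N)
    {D : ∀ L : ℕ+, (Q L).Op →ₗ[ℂ] (links L).Op}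
    (hD : ReturnsToCode D fun L => N L (ketBra (ψ L))) :
    ∀ᶠ L in atTop, ∃ U : (links L).Op, IsLogicalUnitary U ∧
      (∀ φ ∈ codeSpace L, D L (N L (ketBra φ)) = U * ketBra φ * Uᴴ) ∧
      IsRecovery (N L) (conjBy Uᴴ ∘ₗ D L) := by
  obtain ⟨rN, hrN, hN⟩ := hN
  obtain ⟨⟨rD, hrD, hD⟩, hsupp⟩ := hD
  filter_upwards [eventually_range_le hrD hrN, hsupp] with L hL hs
  obtain ⟨κ, _, K, hK⟩ := (hN L).exists_localKraus
  obtain ⟨κ', _, K', hK'⟩ := (hD L).exists_localKraus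
  obtain ⟨U, hU, hφ⟩ := (hK.comp hK').exists_logicalUnitary hL (hψ L).1 (hψ L).2 hs
  have hUU : Uᴴ * U = 1 := Matrix.mem_unitaryGroup_iff'.1 hU.1
  have hUU' : U * Uᴴ = 1 := Matrix.mem_unitaryGroup_iff.1 hU.1
  refine ⟨U, hU, hφ, hK'.isChannel.conjBy_comp (by rwa [Matrix.conjTranspose_conjTranspose]),
    fun φ hφ' => ?_⟩
  have h1 : D L (N L (ketBra φ)) = U * ketBra φ * Uᴴ := hφ φ hφ'
  change Uᴴ * D L (N L (ketBra φ)) * Uᴴᴴ = ketBra φ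
  rw [h1, Matrix.conjTranspose_conjTranspose, mul_assoc, mul_assoc (U * ketBra φ), hUU, mul_one,
    ← mul_assoc, hUU, one_mul]

theorem InToricCodePhase.exists_returnsToCode {Q : ∀ L : ℕ+, Register L} {ρ : ∀ L, (Q L).Op}
    (h : InToricCodePhase ρ) : ∃ D, ReturnsToCode D ρ := by
  obtain ⟨ρa, ρb, C₁, C₂, -, hC₂, h⟩ := h
  refine ⟨C₂, hC₂, h.mono fun L hL => ?_⟩
  rw [hL.2.2.2.2.2]
  exact hL.2.2.2.1

theorem preservesLogicalInfo_of_inToricCodePhase {Q : ∀ L : ℕ+, Register L}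
    {ψ : ∀ L : ℕ+, (links L).Vec} (hψ : ∀ L, ψ L ∈ codeSpace L ∧ IsUnitVector (ψ L))
    {N : ∀ L : ℕ+, (links L).Op →ₗ[ℂ] (Q L).Op} (hN : IsLCFamily N)
    (h : InToricCodePhase fun L => N L (ketBra (ψ L))) : PreservesLogicalInfo N := by
  obtain ⟨D, hD⟩ := h.exists_returnsToCode
  exact (eventually_exists_recovery hψ hN hD).mono fun L ⟨U, _, _, hR⟩ => ⟨_, hR⟩

end ToricCode

end

theorem mainTheorem3 (Q : ∀ L : ℕ+, ToricCode.Register L)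
    (ψ : ∀ L : ℕ+, (ToricCode.links L).Vec)
    (hψ : ∀ L, ψ L ∈ ToricCode.codeSpace L ∧ ToricCode.IsUnitVector (ψ L)) :
    (∀ N : ∀ L : ℕ+, (ToricCode.links L).Op →ₗ[ℂ] (Q L).Op,
      ToricCode.IsLCFamily N →
      ToricCode.InToricCodePhase (fun L => N L (ToricCode.ketBra (ψ L))) →
      ToricCode.PreservesLogicalInfo N ∧
      (∃ D : ∀ L : ℕ+, (Q L).Op →ₗ[ℂ] (ToricCode.links L).Op,
        ToricCode.ReturnsToCode D (fun L => N L (ToricCode.ketBra (ψ L)))) ∧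
      ∀ D : ∀ L : ℕ+, (Q L).Op →ₗ[ℂ] (ToricCode.links L).Op,
        ToricCode.ReturnsToCode D (fun L => N L (ToricCode.ketBra (ψ L))) →
        ∀ᶠ L in atTop, ∃ U : (ToricCode.links L).Op, ToricCode.IsLogicalUnitary U ∧
          (∀ φ ∈ ToricCode.codeSpace L,
            D L (N L (ToricCode.ketBra φ)) = U * ToricCode.ketBra φ * Uᴴ) ∧
          ToricCode.IsRecovery (N L) (ToricCode.conjBy Uᴴ ∘ₗ D L)) ∧
    (∀ (I : Set ℝ≥0) (N : ℝ≥0 → ∀ L : ℕ+, (ToricCode.links L).Op →ₗ[ℂ] (Q L).Op),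
      (∀ p ∈ I, ToricCode.IsLCFamily (N p)) →
      ToricCode.pTC I N ψ ≤ ToricCode.pCoding I N) := by
  refine ⟨fun N hN hTC => ⟨ToricCode.preservesLogicalInfo_of_inToricCodePhase hψ hN hTC,
    hTC.exists_returnsToCode, fun D hD => ToricCode.eventually_exists_recovery hψ hN hD⟩,
    fun I N hN => ?_⟩
  -- Every strength beyond which coding always fails is also one beyond which the phase is always
  -- lost, so the second infimum runs over a smaller set.
  refine sInf_le_sInf fun t ht p hp htp hTC => ht p hp htp ?_
  exact ToricCode.preservesLogicalInfo_of_inToricCodePhase hψ (hN p hp) hTC
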